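/- Let $0<\alpha<1$, let $p:\mathbb{R}\to\mathbb{R}$ be continuous and $2\pi$-periodic, and let $p_1,p_2$ be constants with $p_2\le p(t)\le p_1<0$ for all $t$. Put $\eta=((\alpha-1)p_1)^{-1/\alpha}$ and $\gamma=\sqrt{2(p_1-p_2)\eta}$, and consider the equation $$\ddot u-\frac1{u^\alpha}=p(t),\qquad u>0. \tag{E}$$ For every $(t_0,v_0)\in\mathbb{R}\times(\gamma,+\infty)$ there is exactly one pair $(t_1,w)$ with $t_1>t_0$ for which (E) has a classical solution $u>0$ on $(t_0,t_1)$ with $$\lim_{t\to t_0^+}u(t)=\lim_{t\to t_1^-}u(t)=0,\qquad \lim_{t\to t_0^+}\dot u(t)=v_0,\qquad \lim_{t\to t_1^-}\dot u(t)=-w,$$ and $w>0$. The successor map $$S:\mathbb{R}\times(\gamma,+\infty)\to\mathbb{R}\times\mathbb{R}^+,\qquad S(t_0,v_0)=(t_1,w)=(t_1,-\dot u(t_1^-)),$$ is therefore well defined, and it is area-preserving, where $(t,v)$ are regarded as polar coordinates (angle $t$, radius $v$), so that the area element is $v\,dt\,dv$: for every Borel set $A\subseteq\mathbb{R}\times(\gamma,+\infty)$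 the image $S(A)$ is a Borel set and $$\iint_{S(A)}v\,dt\,dv=\iint_A v\,dt\,dv .$$ -/

import Mathlib

open Set Filter Topology MeasureTheory

noncomputable section

/-- `u` is a positive classical solution of `u'' - 1 / u ^ α = p t` on the (open) set `I`. The
second derivative is then automatically continuous on `I` when `p` is continuous. -/
def IsClassicalSolutionOn (α : ℝ) (p u : ℝ → ℝ) (I : Set ℝ) : Prop :=
  ∀ t ∈ I, 0 < u t ∧ DifferentiableAt ℝ u t ∧ HasDerivAt (deriv u) (1 / (u t) ^ α + p t) t

/-- `IsSuccessor α p (t₀, v₀) (t₁, w)`: there is a positive classical solution on `(t₀, t₁)` that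
leaves the singularity `u = 0` at time `t₀` with velocity `v₀` and comes back to it (for the first
time) at time `t₁ > t₀` with velocity `-w`. -/
def IsSuccessor (α : ℝ) (p : ℝ → ℝ) (x y : ℝ × ℝ) : Prop :=
  x.1 < y.1 ∧ ∃ u : ℝ → ℝ,
    IsClassicalSolutionOn α p u (Ioo x.1 y.1) ∧
    Tendsto u (𝓝[>] x.1) (𝓝 0) ∧
    Tendsto (deriv u) (𝓝[>] x.1) (𝓝 x.2) ∧
    Tendsto u (𝓝[<] y.1) (𝓝 0) ∧
    Tendsto (deriv u) (𝓝[<] y.1) (𝓝 (-y.2))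

/-- The successor map `S (t₀, v₀) = (t₁, -u'(t₁⁻))` (an arbitrary value is taken at the points
that have no successor). -/
def successorMap (α : ℝ) (p : ℝ → ℝ) (x : ℝ × ℝ) : ℝ × ℝ :=
  Classical.epsilon (IsSuccessor α p x)

/-- The velocity threshold `γ = √(2 (p₁ - p₂) η)`, where `η = ((α - 1) p₁) ^ (-1 / α)`. -/
def velocityThreshold (α p₁ p₂ : ℝ) : ℝ :=
  Real.sqrt (2 * (p₁ - p₂) * ((α - 1) * p₁) ^ (-1 / α))

/-- The domain `ℝ × (γ, +∞)` of the successor map. -/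
def successorDomain (α p₁ p₂ : ℝ) : Set (ℝ × ℝ) :=
  (univ : Set ℝ) ×ˢ Ioi (velocityThreshold α p₁ p₂)

/-- The area on the space of pairs `(t, v)`, with `t` as angle and `v > 0` as radius of polar
coordinates: the measure with area element `v dt dv`. -/
def polarArea : Measure (ℝ × ℝ) :=
  (volume : Measure (ℝ × ℝ)).withDensity (fun x => ENNReal.ofReal x.2)

/-- `S` is area-preserving on `D`: it carries every Borel set `A ⊆ D` to a Borel set of the same
area. -/
def IsAreaPreservingOn (S : ℝ × ℝ → ℝ × ℝ) (D : Set (ℝ × ℝ)) : Prop :=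
  ∀ A : Set (ℝ × ℝ), A ⊆ D → MeasurableSet A →
    MeasurableSet (S '' A) ∧ polarArea (S '' A) = polarArea A

end

/-!
The singularity of `u'' = u ^ (-α) + p t` at `u = 0` is removed by a change of variables. Put
`m = (1 - α) / 2`, `s = u ^ m`, `z = u' - P t` with `P' = p`, and take a new time `τ` with
`dt = u ^ (1 - m) dτ`. With `q = 1 / m - 1 = (1 + α) / (1 - α) > 1` the equation becomes the
autonomous system
`dt/dτ = s ^ q`, `ds/dτ = m (z + P t)`, `dz/dτ = s`,
whose right-hand side is of class `C¹` up to `s = 0` although `p` is merely continuous (the variable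
`z` replaces `u'` so that only `P`, and not `p`, occurs), and which is divergence free. After
cutting off `s ^ q` (`cutoffPow`) the field `regField` is globally Lipschitz, so that all orbits are
global (`exists_global_solution`), and the successor map is the first return map to the plane
`s = 0`.

* Existence: the energy `u' ^ 2 / 2 - u ^ (1 - α) / (1 - α) - c u` changes at the rate
  `(p t - c) u'`. With `c = p₂` on the way up the condition `v₀ > γ` forces `u` up to the height
  `η`; above `η` the acceleration is negative and bounded away from zero, so `u` turns around below
  an upper bound given by `c = p₁`; with `c = p₁` on the way down the velocity cannot vanish before
  `u = 0` (`IsRegOrbit.exists_return`, `IsRegOrbit.isSuccessor`).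
* Uniqueness: two solutions that leave the singularity with the same positive velocity agree
  (`eq_of_start`), hence successors are unique, and by time reversal the successor map is injective.
* Area: the flow is differentiable in its initial condition (`hasFDerivAt_flow`). Since `dt/dτ` and
  `dz/dτ` vanish on the plane `s = 0`, the derivative of the return map in the coordinates `(t, z)`
  is a minor of the derivative of the flow at the fixed return time. The determinant of two
  variations and of the velocity `(0, m v, 0)` of the field is conserved (`regField_wronskian_eq`),
  so the Jacobian determinant of the successor map at `(t₀, v₀)` is `v₀ / w`
  (`hasFDerivAt_firstReturn`). This is the factor by which the change of variables formula turns
  the density `w` into the density `v₀`.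
-/

/-! ### Global solutions of Lipschitz equations -/

theorem abs_integral_exp_mul_abs_le {L : ℝ} (hL : 0 < L) (t : ℝ) :
    |∫ s in (0 : ℝ)..t, Real.exp (L * |s|)| ≤ Real.exp (L * |t|) / L := by
  have key : ∀ r : ℝ, 0 ≤ r → ∫ s in (0 : ℝ)..r, Real.exp (L * |s|) = (Real.exp (L * r) - 1) / L := by
    intro r hr
    have h1 : ∫ s in (0 : ℝ)..r, Real.exp (L * |s|) = ∫ s in (0 : ℝ)..r, Real.exp (L * s) := by
      apply intervalIntegral.integral_congr
      intro s hs
      rw [uIcc_of_le hr] at hs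
      simp [abs_of_nonneg hs.1]
    rw [h1, intervalIntegral.integral_comp_mul_left _ hL.ne', integral_exp]
    simp [div_eq_inv_mul]
  have bound : ∀ r : ℝ, 0 ≤ r → |(Real.exp (L * r) - 1) / L| ≤ Real.exp (L * r) / L := by
    intro r hr
    have : 1 ≤ Real.exp (L * r) := Real.one_le_exp (by positivity)
    rw [abs_of_nonneg (div_nonneg (by linarith) hL.le)]
    gcongr
    linarith
  rcases le_total 0 t with ht | ht
  · rw [key t ht, abs_of_nonneg ht]
    exact bound t ht
  · have h2 : ∫ s in (0 : ℝ)..t, Real.exp (L * |s|) = -∫ s in (0 : ℝ)..(-t), Real.exp (L * |s|) := by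
      have := intervalIntegral.integral_comp_neg (a := 0) (b := t)
        (fun s => Real.exp (L * |s|))
      simp only [abs_neg, neg_zero] at this
      rw [this, intervalIntegral.integral_symm]
    rw [h2, abs_neg, key _ (by linarith), abs_of_nonpos ht]
    exact bound _ (by linarith)

/-- A continuous time-dependent vector field that is uniformly Lipschitz in space and bounded at
the origin has integral curves defined for all times. The curve is the fixed point of the Picard
operator in the weighted sup norm `sup ‖x t‖ e^{-(K + 1) |t|}`, in which it is a contraction. -/
theorem exists_global_solution {E : Type*} [NormedAddCommGroup E] [NormedSpace ℝ E]
    [CompleteSpace E] {f : ℝ → E → E} {K : NNReal} {C : ℝ}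
    (hf : ∀ x, Continuous fun t => f t x) (hK : ∀ t, LipschitzWith K (f t))
    (hC : ∀ t, ‖f t 0‖ ≤ C) (x₀ : E) :
    ∃ x : ℝ → E, x 0 = x₀ ∧ ∀ t, HasDerivAt x (f t (x t)) t := by
  set L : ℝ := K + 1 with hLdef
  have hL : 0 < L := by positivity
  have hC0 : 0 ≤ C := (norm_nonneg _).trans (hC 0)
  have hcont : Continuous (Function.uncurry f) :=
    continuous_prod_of_continuous_lipschitzWith' _ K hK hf
  have hgrow : ∀ t x, ‖f t x‖ ≤ C + K * ‖x‖ := by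
    intro t x
    have h1 := (hK t).dist_le_mul x 0
    rw [dist_eq_norm, dist_zero_right] at h1
    calc ‖f t x‖ = ‖f t 0 + (f t x - f t 0)‖ := by congr 1; abel
      _ ≤ ‖f t 0‖ + ‖f t x - f t 0‖ := norm_add_le _ _
      _ ≤ C + K * ‖x‖ := add_le_add (hC t) h1
  let w : ℝ → ℝ := fun t => Real.exp (L * |t|)
  have hw : Continuous w := by fun_prop
  have hwpos : ∀ t, 0 < w t := fun t => Real.exp_pos _
  have hw1 : ∀ t, 1 ≤ w t := fun t => Real.one_le_exp (by positivity)
  let J : (BoundedContinuousFunction ℝ E) → ℝ → E := fun y s => f s (w s • y s)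
  have hJ : ∀ y, Continuous (J y) := fun y =>
    hcont.comp (continuous_id.prodMk (hw.smul y.continuous))
  let G : (BoundedContinuousFunction ℝ E) → ℝ → E := fun y t => x₀ + ∫ s in (0 : ℝ)..t, J y s
  have hGd : ∀ y t, HasDerivAt (G y) (J y t) t := fun y t =>
    (intervalIntegral.integral_hasDerivAt_right ((hJ y).intervalIntegrable _ _)
      ((hJ y).stronglyMeasurableAtFilter _ _) (hJ y).continuousAt).const_add _
  have hGc : ∀ y, Continuous (G y) := fun y =>
    continuous_iff_continuousAt.2 fun t => (hGd y t).continuousAt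
  -- integrals of functions dominated by a multiple of the weight
  have hint : ∀ (h : ℝ → E) (M : ℝ), (∀ s, ‖h s‖ ≤ M * w s) → ∀ t,
      ‖∫ s in (0 : ℝ)..t, h s‖ ≤ M * (w t / L) := by
    intro h M hM t
    have hM0 : 0 ≤ M := by
      have := (norm_nonneg _).trans (hM 0)
      exact nonneg_of_mul_nonneg_left this (hwpos 0)
    calc ‖∫ s in (0 : ℝ)..t, h s‖ ≤ |∫ s in (0 : ℝ)..t, M * w s| := by
          apply intervalIntegral.norm_integral_le_abs_of_norm_le
          · exact Filter.Eventually.of_forall fun s => hM s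
          · exact (continuous_const.mul hw).intervalIntegrable _ _
      _ = M * |∫ s in (0 : ℝ)..t, w s| := by
          rw [intervalIntegral.integral_const_mul, abs_mul, abs_of_nonneg hM0]
      _ ≤ M * (w t / L) := by
          gcongr
          exact abs_integral_exp_mul_abs_le hL t
  have hGb : ∀ y t, ‖(w t)⁻¹ • G y t‖ ≤ ‖x₀‖ + (C + K * ‖y‖) / L := by
    intro y t
    have h1 : ‖∫ s in (0 : ℝ)..t, J y s‖ ≤ (C + K * ‖y‖) * (w t / L) := by
      apply hint
      intro s
      calc ‖J y s‖ ≤ C + K * ‖w s • y s‖ := hgrow _ _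
        _ = C + K * (w s * ‖y s‖) := by
          rw [norm_smul, Real.norm_of_nonneg (hwpos s).le]
        _ ≤ C * w s + K * (w s * ‖y‖) := by
          gcongr
          · exact le_mul_of_one_le_right hC0 (hw1 s)
          · exact y.norm_coe_le_norm s
        _ = (C + K * ‖y‖) * w s := by ring
    rw [norm_smul, norm_inv, Real.norm_of_nonneg (hwpos t).le]
    calc (w t)⁻¹ * ‖G y t‖ ≤ (w t)⁻¹ * (‖x₀‖ * w t + (C + K * ‖y‖) * (w t / L)) := by
          have := hwpos t
          gcongr
          refine (norm_add_le _ _).trans (add_le_add ?_ h1)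
          exact le_mul_of_one_le_right (norm_nonneg _) (hw1 t)
      _ = ‖x₀‖ + (C + K * ‖y‖) / L := by
          have := (hwpos t).ne'
          field_simp
  let T : (BoundedContinuousFunction ℝ E) → (BoundedContinuousFunction ℝ E) := fun y =>
    BoundedContinuousFunction.ofNormedAddCommGroup (fun t => (w t)⁻¹ • G y t)
      ((hw.inv₀ fun t => (hwpos t).ne').smul (hGc y)) _ (hGb y)
  have hT : ContractingWith (K / (K + 1)) T := by
    refine ⟨?_, LipschitzWith.of_dist_le_mul fun y y' => ?_⟩
    · rw [div_lt_one (by positivity)]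
      exact lt_add_one K
    · rw [BoundedContinuousFunction.dist_le (by positivity)]
      intro t
      have hd : ‖∫ s in (0 : ℝ)..t, (J y s - J y' s)‖ ≤ (K * dist y y') * (w t / L) := by
        apply hint
        intro s
        rw [← dist_eq_norm]
        calc dist (J y s) (J y' s) ≤ K * dist (w s • y s) (w s • y' s) := (hK s).dist_le_mul _ _
          _ = K * (w s * dist (y s) (y' s)) := by
            rw [dist_smul₀, Real.norm_of_nonneg (hwpos s).le]
          _ ≤ K * (w s * dist y y') := by
            have := hwpos s
            gcongr
            exact BoundedContinuousFunction.dist_coe_le_dist s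
          _ = _ := by ring
      have hsub : G y t - G y' t = ∫ s in (0 : ℝ)..t, (J y s - J y' s) := by
        rw [intervalIntegral.integral_sub ((hJ y).intervalIntegrable _ _)
          ((hJ y').intervalIntegrable _ _)]
        simp [G]
      change dist ((w t)⁻¹ • G y t) ((w t)⁻¹ • G y' t) ≤ _
      rw [dist_smul₀, dist_eq_norm, hsub, norm_inv, Real.norm_of_nonneg (hwpos t).le]
      calc (w t)⁻¹ * ‖∫ s in (0 : ℝ)..t, (J y s - J y' s)‖
          ≤ (w t)⁻¹ * ((K * dist y y') * (w t / L)) := by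
            have := hwpos t
            gcongr
        _ = ((K / (K + 1) : NNReal) : ℝ) * dist y y' := by
            have := (hwpos t).ne'
            push_cast
            rw [← hLdef]
            field_simp
  obtain ⟨y, hy⟩ : ∃ y, T y = y := ⟨_, hT.fixedPoint_isFixedPt⟩
  have hyG : ∀ t, w t • y t = G y t := by
    intro t
    have h1 : y t = (w t)⁻¹ • G y t := by
      conv_lhs => rw [← hy]
      rfl
    rw [h1, smul_inv_smul₀ (hwpos t).ne']
  refine ⟨G y, by simp [G], fun t => ?_⟩
  have := hGd y t
  simp only [J, hyG] at this
  exact this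

/-! ### Differentiability of the flow in its initial condition -/

/-- The first-order Taylor estimate of a `C¹` map holds uniformly along a compact set. -/
theorem IsCompact.exists_norm_taylor_one_le {E F : Type*} [NormedAddCommGroup E]
    [NormedSpace ℝ E] [NormedAddCommGroup F] [NormedSpace ℝ F] {f : E → F} {f' : E → E →L[ℝ] F}
    (hf : ∀ x, HasFDerivAt f (f' x) x) (hf' : Continuous f') {S : Set E} (hS : IsCompact S)
    {ε : ℝ} (hε : 0 < ε) :
    ∃ ρ > 0, ∀ x ∈ S, ∀ h, ‖h‖ < ρ → ‖f (x + h) - f x - f' x h‖ ≤ ε * ‖h‖ := by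
  have h1 := hS.uniformContinuousAt_of_continuousAt f' (fun a _ => hf'.continuousAt)
    (Metric.dist_mem_uniformity hε)
  obtain ⟨ρ, hρ, h2⟩ := Metric.mem_uniformity_dist.1 h1
  refine ⟨ρ, hρ, fun x hx h hh => ?_⟩
  have h3 := (convex_ball x ρ).norm_image_sub_le_of_norm_hasFDerivWithin_le' (φ := f' x)
    (f := f) (f' := f') (C := ε) (x := x) (y := x + h)
    (fun y _ => (hf y).hasFDerivWithinAt) ?_ (Metric.mem_ball_self hρ) (by simpa using hh)
  · simpa using h3
  · intro y hy
    have : dist (f' x) (f' y) < ε := h2 (a := x) (b := y) (by rw [dist_comm]; exact hy) hx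
    rw [dist_comm, dist_eq_norm] at this
    exact this.le

/-- The flow of a Lipschitz `C¹` vector field is differentiable with respect to a parameter on
which the initial condition depends differentiably, and its derivative solves the variational
equation along the base orbit. -/
theorem hasFDerivAt_flow {G E : Type*} [NormedAddCommGroup G] [NormedSpace ℝ G]
    [NormedAddCommGroup E] [NormedSpace ℝ E] {F : E → E} {F' : E → E →L[ℝ] E} {K : NNReal}
    (hF : ∀ x, HasFDerivAt F (F' x) x) (hF' : Continuous F') (hK : LipschitzWith K F)
    {Φ : G → ℝ → E} (hΦ : ∀ x t, HasDerivAt (Φ x) (F (Φ x t)) t) {x₀ : G}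
    {Y : ℝ → G →L[ℝ] E} (hY : ∀ t, HasDerivAt Y ((F' (Φ x₀ t)).comp (Y t)) t)
    (h₀ : HasFDerivAt (fun x => Φ x 0) (Y 0) x₀) {T : ℝ} (hT : 0 ≤ T) :
    HasFDerivAt (fun x => Φ x T) (Y T) x₀ := by
  have hΦc : Continuous (Φ x₀) := continuous_iff_continuousAt.2 fun t => (hΦ x₀ t).continuousAt
  have hYc : Continuous Y := continuous_iff_continuousAt.2 fun t => (hY t).continuousAt
  obtain ⟨C, hC⟩ := (isCompact_Icc (a := (0 : ℝ)) (b := T)).exists_bound_of_continuousOn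
    hYc.continuousOn
  have hC0 : 0 ≤ C := (norm_nonneg _).trans (hC 0 ⟨le_rfl, hT⟩)
  have hS : IsCompact (Φ x₀ '' Icc 0 T) := isCompact_Icc.image hΦc
  rw [hasFDerivAt_iff_isLittleO_nhds_zero, Asymptotics.isLittleO_iff] at h₀ ⊢
  intro c hc
  -- Gronwall's bound is linear in the initial discrepancy and in the error of the field
  set M : ℝ := gronwallBound 1 K (C + 1) T with hM
  have hMpos : 0 < M := by
    have := gronwallBound_mono (δ := 1) (K := K) (ε := C + 1) (by norm_num) (by positivity)
      K.2 hT
    rw [gronwallBound_x0] at this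
    linarith
  set ε : ℝ := c / M with hε
  have hεpos : 0 < ε := by positivity
  obtain ⟨ρ, hρ, hTay⟩ := hS.exists_norm_taylor_one_le hF hF' hεpos
  have hsmall : ∀ᶠ h : G in 𝓝 0, C * ‖h‖ < ρ := by
    have : Tendsto (fun h : G => C * ‖h‖) (𝓝 0) (𝓝 (C * ‖(0 : G)‖)) :=
      (continuous_const.mul continuous_norm).tendsto 0
    rw [norm_zero, mul_zero] at this
    exact this.eventually (gt_mem_nhds hρ)
  filter_upwards [h₀ hεpos, hsmall] with h hh hsm
  have hlin : ∀ t, HasDerivAt (fun s => Φ x₀ s + Y s h)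
      (F (Φ x₀ t) + F' (Φ x₀ t) (Y t h)) t := by
    intro t
    have := (hΦ x₀ t).add ((hY t).clm_apply (hasDerivAt_const t h))
    simp only [map_zero, add_zero, ContinuousLinearMap.comp_apply] at this
    exact this
  have hgr := dist_le_of_approx_trajectories_ODE (v := fun _ => F) (K := K) (a := 0) (b := T)
    (f := Φ (x₀ + h)) (g := fun s => Φ x₀ s + Y s h) (εf := 0) (εg := ε * (C * ‖h‖))
    (δ := ε * ‖h‖) (f' := fun t => F (Φ (x₀ + h) t))
    (g' := fun t => F (Φ x₀ t) + F' (Φ x₀ t) (Y t h)) (fun _ => hK)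
    (fun t _ => (hΦ _ t).continuousAt.continuousWithinAt)
    (fun t _ => (hΦ _ t).hasDerivWithinAt) (fun t _ => by simp)
    (fun t _ => (hlin t).continuousAt.continuousWithinAt)
    (fun t _ => (hlin t).hasDerivWithinAt) ?_ ?_ T ⟨hT, le_rfl⟩
  · rw [dist_eq_norm, sub_zero] at hgr
    have hle : gronwallBound (ε * ‖h‖) K (0 + ε * (C * ‖h‖)) T ≤ ε * ‖h‖ * M := by
      rw [hM]
      unfold gronwallBound
      split_ifs with hK0
      · have : 0 ≤ ε * ‖h‖ * T := by positivity
        linarith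
      · have hKpos : (0 : ℝ) < K := lt_of_le_of_ne K.2 (Ne.symm hK0)
        have h1 : 1 ≤ Real.exp (K * T) := Real.one_le_exp (by positivity)
        have : 0 ≤ ε * ‖h‖ * ((1 / K) * (Real.exp (K * T) - 1)) :=
          mul_nonneg (by positivity) (mul_nonneg (by positivity) (by linarith))
        calc ε * ‖h‖ * Real.exp (K * T) + (0 + ε * (C * ‖h‖)) / K * (Real.exp (K * T) - 1)
            ≤ ε * ‖h‖ * Real.exp (K * T) + (0 + ε * (C * ‖h‖)) / K * (Real.exp (K * T) - 1)
              + ε * ‖h‖ * ((1 / K) * (Real.exp (K * T) - 1)) := by linarith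
          _ = _ := by ring
    calc ‖Φ (x₀ + h) T - Φ x₀ T - Y T h‖ = ‖Φ (x₀ + h) T - (Φ x₀ T + Y T h)‖ := by
          rw [sub_sub]
      _ ≤ ε * ‖h‖ * M := hgr.trans hle
      _ = c * ‖h‖ := by rw [hε]; field_simp
  · intro t ht
    have htI : t ∈ Icc 0 T := ⟨ht.1, ht.2.le⟩
    have hYh : ‖Y t h‖ ≤ C * ‖h‖ := (Y t).le_of_opNorm_le (hC t htI) h
    have := hTay _ (mem_image_of_mem _ htI) (Y t h) (hYh.trans_lt hsm)
    rw [dist_comm, dist_eq_norm, ← sub_sub]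
    exact this.trans (by gcongr)
  · rw [dist_eq_norm, ← sub_sub]
    exact hh

/-! ### The regularised vector field -/

noncomputable section

/-- The power `s ↦ s ^ q`, cut off to a globally Lipschitz function: it vanishes for `s ≤ 0`, equals
`s ^ q` on `[0, R]` and is affine beyond `R`. -/
def cutoffPow (q R s : ℝ) : ℝ := ∫ σ in (0 : ℝ)..s, q * (max 0 (min σ R)) ^ (q - 1)

/-- The derivative of `cutoffPow q R`. -/
def cutoffPowDeriv (q R s : ℝ) : ℝ := q * (max 0 (min s R)) ^ (q - 1)

theorem continuous_cutoffPowDeriv {q : ℝ} (hq : 1 < q) (R : ℝ) :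
    Continuous (cutoffPowDeriv q R) :=
  continuous_const.mul ((continuous_const.max (continuous_id.min continuous_const)).rpow_const
    fun _ => Or.inr (by linarith))

theorem hasDerivAt_cutoffPow {q : ℝ} (hq : 1 < q) (R s : ℝ) :
    HasDerivAt (cutoffPow q R) (cutoffPowDeriv q R s) s :=
  intervalIntegral.integral_hasDerivAt_right
    ((continuous_cutoffPowDeriv hq R).intervalIntegrable _ _)
    ((continuous_cutoffPowDeriv hq R).stronglyMeasurableAtFilter _ _)
    (continuous_cutoffPowDeriv hq R).continuousAt

theorem abs_cutoffPowDeriv_le {q R : ℝ} (hq : 1 < q) (hR : 0 ≤ R) (s : ℝ) :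
    |cutoffPowDeriv q R s| ≤ q * R ^ (q - 1) := by
  unfold cutoffPowDeriv
  have h0 : (0 : ℝ) ≤ max 0 (min s R) := le_max_left _ _
  rw [abs_of_nonneg (by positivity)]
  have : max 0 (min s R) ≤ R := max_le hR (min_le_right _ _)
  have : 0 ≤ q - 1 := by linarith
  gcongr

theorem cutoffPow_zero (q R : ℝ) : cutoffPow q R 0 = 0 := by simp [cutoffPow]

theorem cutoffPow_eq {q R s : ℝ} (hq : 1 < q) (hs : 0 ≤ s) (hsR : s ≤ R) :
    cutoffPow q R s = s ^ q := by
  have h1 : cutoffPow q R s = ∫ σ in (0 : ℝ)..s, q * σ ^ (q - 1) := by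
    apply intervalIntegral.integral_congr
    intro σ hσ
    rw [uIcc_of_le hs] at hσ
    simp only
    rw [min_eq_left (hσ.2.trans hsR), max_eq_right hσ.1]
  rw [h1, intervalIntegral.integral_const_mul, integral_rpow (Or.inl (by linarith)),
    sub_add_cancel, Real.zero_rpow (by linarith)]
  field_simp
  ring

/-- The antiderivative vanishing at `0` of the forcing term `p`. -/
def forcingPrimitive (p : ℝ → ℝ) (t : ℝ) : ℝ := ∫ r in (0 : ℝ)..t, p r

theorem hasDerivAt_forcingPrimitive {p : ℝ → ℝ} (hp : Continuous p) (t : ℝ) :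
    HasDerivAt (forcingPrimitive p) (p t) t :=
  intervalIntegral.integral_hasDerivAt_right (hp.intervalIntegrable _ _)
    (hp.stronglyMeasurableAtFilter _ _) hp.continuousAt

/-- The regularised vector field `(t, s, z) ↦ (g s, m (z + P t), s)`. With `g s = s ^ (1 / m - 1)`
it describes the equation `u'' = u ^ (2 m - 1) + P'' t` in the variables `s = u ^ m` and
`z = u' - P t` and the new time `τ` with `dt = u ^ (1 - m) dτ`. -/
def regField (m : ℝ) (g P : ℝ → ℝ) (x : ℝ × ℝ × ℝ) : ℝ × ℝ × ℝ :=
  (g x.2.1, m * (x.2.2 + P x.1), x.2.1)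

/-- The derivative of `regField m g P` when `g' = dg` and `P' = p`. -/
def regFieldDeriv (m : ℝ) (dg p : ℝ → ℝ) (x : ℝ × ℝ × ℝ) :
    ℝ × ℝ × ℝ →L[ℝ] ℝ × ℝ × ℝ :=
  let T := ContinuousLinearMap.fst ℝ ℝ (ℝ × ℝ)
  let S := (ContinuousLinearMap.fst ℝ ℝ ℝ).comp (ContinuousLinearMap.snd ℝ ℝ (ℝ × ℝ))
  let Z := (ContinuousLinearMap.snd ℝ ℝ ℝ).comp (ContinuousLinearMap.snd ℝ ℝ (ℝ × ℝ))
  (dg x.2.1 • S).prod ((m • (Z + p x.1 • T)).prod S)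

theorem regFieldDeriv_apply (m : ℝ) (dg p : ℝ → ℝ) (x y : ℝ × ℝ × ℝ) :
    regFieldDeriv m dg p x y = (dg x.2.1 * y.2.1, m * (y.2.2 + p x.1 * y.1), y.2.1) := by
  simp [regFieldDeriv, mul_add]

section

variable {m : ℝ} {g dg P p : ℝ → ℝ}

theorem hasFDerivAt_regField (hg : ∀ s, HasDerivAt g (dg s) s) (hP : ∀ t, HasDerivAt P (p t) t)
    (x : ℝ × ℝ × ℝ) : HasFDerivAt (regField m g P) (regFieldDeriv m dg p x) x := by
  have hT : HasFDerivAt (fun x : ℝ × ℝ × ℝ => x.1) (ContinuousLinearMap.fst ℝ ℝ (ℝ × ℝ)) x :=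
    hasFDerivAt_fst
  have hSZ : HasFDerivAt (fun x : ℝ × ℝ × ℝ => x.2) (ContinuousLinearMap.snd ℝ ℝ (ℝ × ℝ)) x :=
    hasFDerivAt_snd
  have hS := hSZ.fst
  have hZ := hSZ.snd
  have h1 := (hg x.2.1).comp_hasFDerivAt x hS
  have h2 := (hP x.1).comp_hasFDerivAt x hT
  exact h1.prodMk (((hZ.add h2).const_mul m).prodMk hS)

theorem continuous_regFieldDeriv (hdg : Continuous dg) (hp : Continuous p) :
    Continuous (regFieldDeriv m dg p) := by
  unfold regFieldDeriv
  have h1 : Continuous fun x : ℝ × ℝ × ℝ => dg x.2.1 := by fun_prop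
  have h2 : Continuous fun x : ℝ × ℝ × ℝ => p x.1 := by fun_prop
  have h3 := h1.smul (continuous_const (y := (ContinuousLinearMap.fst ℝ ℝ ℝ).comp
    (ContinuousLinearMap.snd ℝ ℝ (ℝ × ℝ))))
  have h4 := ((h2.smul (continuous_const (y := ContinuousLinearMap.fst ℝ ℝ (ℝ × ℝ)))).const_add
    ((ContinuousLinearMap.snd ℝ ℝ ℝ).comp (ContinuousLinearMap.snd ℝ ℝ (ℝ × ℝ)))).const_smul m
  have e := (ContinuousLinearMap.prodₗᵢ ℝ (𝕜 := ℝ) (E := ℝ × ℝ × ℝ) (F := ℝ) (G := ℝ)).continuous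
  have e' := (ContinuousLinearMap.prodₗᵢ ℝ (𝕜 := ℝ) (E := ℝ × ℝ × ℝ) (F := ℝ)
    (G := ℝ × ℝ)).continuous
  exact e'.comp (h3.prodMk (e.comp (h4.prodMk continuous_const)))

theorem lipschitzWith_of_hasDerivAt {f f' : ℝ → ℝ} {C : NNReal} (hf : ∀ s, HasDerivAt f (f' s) s)
    (hC : ∀ s, |f' s| ≤ C) : LipschitzWith C f :=
  lipschitzWith_of_nnnorm_deriv_le (fun s => (hf s).differentiableAt) fun s => by
    rw [(hf s).deriv]
    exact_mod_cast hC s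

theorem exists_lipschitzWith_regField {A B : ℝ} (hg : ∀ s, HasDerivAt g (dg s) s)
    (hP : ∀ t, HasDerivAt P (p t) t) (hA : ∀ s, |dg s| ≤ A) (hB : ∀ t, |p t| ≤ B) :
    ∃ K, LipschitzWith K (regField m g P) := by
  lift A to NNReal using (abs_nonneg _).trans (hA 0)
  lift B to NNReal using (abs_nonneg _).trans (hB 0)
  have hgL := lipschitzWith_of_hasDerivAt hg hA
  have hPL := lipschitzWith_of_hasDerivAt hP hB
  have hT : LipschitzWith 1 (fun x : ℝ × ℝ × ℝ => x.1) := LipschitzWith.prod_fst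
  have hS : LipschitzWith (1 * 1) (fun x : ℝ × ℝ × ℝ => x.2.1) :=
    LipschitzWith.prod_fst.comp LipschitzWith.prod_snd
  have hZ : LipschitzWith (1 * 1) (fun x : ℝ × ℝ × ℝ => x.2.2) :=
    LipschitzWith.prod_snd.comp LipschitzWith.prod_snd
  exact ⟨_, (hgL.comp hS).prodMk
    (((lipschitzWith_smul m).comp (hZ.add (hPL.comp hT))).prodMk hS)⟩

end

end

/-! ### Level crossings of a scalar quantity -/

/-- The first zero of a continuous function that starts positive. -/
theorem exists_first_zero {f : ℝ → ℝ} (hf : Continuous f) {a b : ℝ} (hab : a ≤ b) (ha : 0 < f a)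
    (hb : f b ≤ 0) : ∃ c ∈ Ioc a b, f c = 0 ∧ ∀ σ ∈ Ico a c, 0 < f σ := by
  have hS : IsCompact (Icc a b ∩ f ⁻¹' Iic 0) :=
    isCompact_Icc.inter_right (isClosed_Iic.preimage hf)
  obtain ⟨c, ⟨hcI, hc0⟩, hleast⟩ := hS.exists_isLeast ⟨b, ⟨hab, le_rfl⟩, hb⟩
  have hpos : ∀ σ ∈ Ico a c, 0 < f σ := by
    intro σ hσ
    by_contra! h
    exact absurd (hleast ⟨⟨hσ.1, hσ.2.le.trans hcI.2⟩, h⟩) (not_le.2 hσ.2)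
  have hac : a < c := by
    rcases hcI.1.eq_or_lt with h | h
    · rw [← h] at hc0
      exact absurd hc0 (not_le.2 ha)
    · exact h
  refine ⟨c, ⟨hac, hcI.2⟩, le_antisymm hc0 ?_, hpos⟩
  have : f c ∈ closure (Ioi 0) := by
    refine hf.continuousWithinAt.mem_closure (s := Ico a c) (x := c) ?_ hpos
    rw [closure_Ico hac.ne]
    exact ⟨hac.le, le_rfl⟩
  rwa [closure_Ioi] at this

section

variable {m : ℝ} {s v : ℝ → ℝ}

theorem continuous_of_forall_hasDerivAt {f f' : ℝ → ℝ} (hf : ∀ x, HasDerivAt f (f' x) x) :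
    Continuous f :=
  continuous_iff_continuousAt.2 fun x => (hf x).continuousAt

theorem monotoneOn_Icc_of_hasDerivAt_nonneg {f f' : ℝ → ℝ} (hf : ∀ x, HasDerivAt f (f' x) x)
    {a b : ℝ} (h : ∀ x ∈ Icc a b, 0 ≤ f' x) : MonotoneOn f (Icc a b) :=
  monotoneOn_of_deriv_nonneg (convex_Icc a b) (continuous_of_forall_hasDerivAt hf).continuousOn
    (fun x _ => (hf x).differentiableAt.differentiableWithinAt) fun x hx => by
      rw [(hf x).deriv]
      exact h x (interior_subset hx)

theorem antitoneOn_Icc_of_hasDerivAt_nonpos {f f' : ℝ → ℝ} (hf : ∀ x, HasDerivAt f (f' x) x)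
    {a b : ℝ} (h : ∀ x ∈ Icc a b, f' x ≤ 0) : AntitoneOn f (Icc a b) :=
  antitoneOn_of_deriv_nonpos (convex_Icc a b) (continuous_of_forall_hasDerivAt hf).continuousOn
    (fun x _ => (hf x).differentiableAt.differentiableWithinAt) fun x hx => by
      rw [(hf x).deriv]
      exact h x (interior_subset hx)

theorem mul_sub_le_of_le_hasDerivAt {f f' : ℝ → ℝ} (hf : ∀ x, HasDerivAt f (f' x) x) {a b c : ℝ}
    (hab : a ≤ b) (h : ∀ x ∈ Icc a b, c ≤ f' x) : c * (b - a) ≤ f b - f a :=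
  (convex_Icc a b).mul_sub_le_image_sub_of_le_deriv
    (continuous_of_forall_hasDerivAt hf).continuousOn
    (fun x _ => (hf x).differentiableAt.differentiableWithinAt)
    (fun x hx => by rw [(hf x).deriv]; exact h x (interior_subset hx)) a ⟨le_rfl, hab⟩ b
    ⟨hab, le_rfl⟩ hab

/-- A quantity `s` with rate `m v` reaches the level `B` in finite time as soon as the bound
`v ≥ c > 0` holds for as long as `v ≥ 0` and `s ≤ B`. -/
theorem exists_crossing (hm : 0 < m) (hs : ∀ τ, HasDerivAt s (m * v τ) τ) (hv : Continuous v)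
    {a B c : ℝ} (hsa : s a < B) (hva : 0 ≤ v a) (hc : 0 < c)
    (H : ∀ τ, a ≤ τ → (∀ σ ∈ Icc a τ, 0 ≤ v σ ∧ s σ ≤ B) → c ≤ v τ) :
    ∃ b, a < b ∧ s b = B ∧ (∀ σ ∈ Icc a b, 0 < v σ) ∧ ∀ σ ∈ Ico a b, s σ < B := by
  have hsc : Continuous s := continuous_of_forall_hasDerivAt hs
  have hva' : 0 < v a := by
    refine hc.trans_le (H a le_rfl fun σ hσ => ?_)
    rw [le_antisymm hσ.2 hσ.1]
    exact ⟨hva, hsa.le⟩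
  have claim : ∀ b, a ≤ b → (∀ σ ∈ Icc a b, s σ ≤ B) → ∀ σ ∈ Icc a b, 0 < v σ := by
    intro b _ hB σ hσ
    by_contra! hneg
    obtain ⟨ζ, hζ, hζ0, hζpos⟩ := exists_first_zero hv hσ.1 hva' hneg
    have := H ζ hζ.1.le fun r hr => by
      refine ⟨?_, hB r ⟨hr.1, hr.2.trans (hζ.2.trans hσ.2)⟩⟩
      rcases hr.2.eq_or_lt with h | h
      · rw [h, hζ0]
      · exact (hζpos r ⟨hr.1, h⟩).le
    linarith
  obtain ⟨b', hb', hsb'⟩ : ∃ b', a ≤ b' ∧ B ≤ s b' := by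
    by_contra! hcon
    have hr : 0 < (B - s a) / (m * c) := div_pos (by linarith) (by positivity)
    have hle : a ≤ a + (B - s a) / (m * c) := by linarith
    have hgrow := mul_sub_le_of_le_hasDerivAt hs (c := m * c) hle fun x hx => by
      have := H x hx.1 fun σ hσ => ⟨(claim x hx.1 (fun r hr => (hcon r hr.1).le) σ hσ).le,
        (hcon σ hσ.1).le⟩
      gcongr
    have h2 := hcon _ hle
    rw [add_sub_cancel_left, mul_div_cancel₀ _ (by positivity)] at hgrow
    linarith
  obtain ⟨b, hb, hb0, hbpos⟩ := exists_first_zero (f := fun τ => B - s τ) (by fun_prop) hb'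
    (by linarith) (by linarith)
  have hlt : ∀ σ ∈ Ico a b, s σ < B := fun σ hσ => by linarith [hbpos σ hσ]
  have hsb : s b = B := by linarith
  refine ⟨b, hb.1, hsb, claim b hb.1.le fun σ hσ => ?_, hlt⟩
  rcases hσ.2.eq_or_lt with h | h
  · rw [h, hsb]
  · exact (hlt σ ⟨hσ.1, h⟩).le

/-- A quantity `s` with rate `m v` that leaves the level `B` upwards, and whose velocity decreases
at a definite rate above `B`, comes back to `B`; in between it turns around exactly once. -/
theorem exists_turning_return (hm : 0 < m) (hs : ∀ τ, HasDerivAt s (m * v τ) τ) {v' : ℝ → ℝ}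
    (hv : ∀ τ, HasDerivAt v (v' τ) τ) {a B c : ℝ} (hsa : s a = B) (hva : 0 < v a) (hc : 0 < c)
    (H : ∀ τ, a ≤ τ → B ≤ s τ → v' τ ≤ -c) :
    ∃ r b, a < r ∧ r < b ∧ s b = B ∧ v r = 0 ∧ (∀ σ ∈ Ico a r, 0 < v σ) ∧
      (∀ σ ∈ Ioc r b, v σ < 0) ∧ ∀ σ ∈ Ioo a b, B < s σ := by
  have hsc : Continuous s := continuous_of_forall_hasDerivAt hs
  have hvc : Continuous v := continuous_of_forall_hasDerivAt hv
  obtain ⟨ε, hε, hvε⟩ : ∃ ε > 0, ∀ σ ∈ Icc a (a + ε), 0 < v σ := by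
    obtain ⟨ε, hε, h⟩ := Metric.eventually_nhds_iff.1
      (hvc.continuousAt.eventually (lt_mem_nhds hva))
    refine ⟨ε / 2, by positivity, fun σ hσ => h ?_⟩
    rw [Real.dist_eq, abs_lt]
    constructor <;> linarith [hσ.1, hσ.2]
  have hmonoε : StrictMonoOn s (Icc a (a + ε)) :=
    strictMonoOn_of_deriv_pos (convex_Icc _ _) hsc.continuousOn fun x hx => by
      rw [(hs x).deriv]
      exact mul_pos hm (hvε x (interior_subset hx))
  have hε' : ∀ σ ∈ Ioc a (a + ε), B < s σ := by
    intro σ hσ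
    rw [← hsa]
    exact hmonoε ⟨le_rfl, by linarith⟩ ⟨hσ.1.le, hσ.2⟩ hσ.1
  obtain ⟨b', hb', hsb'⟩ : ∃ b', a + ε ≤ b' ∧ s b' ≤ B := by
    by_contra! hcon
    have hB : ∀ τ, a ≤ τ → B ≤ s τ := by
      intro τ hτ
      rcases hτ.eq_or_lt with h | h
      · rw [← h, hsa]
      · rcases le_total τ (a + ε) with h' | h'
        · exact (hε' τ ⟨h, h'⟩).le
        · exact (hcon τ h').le
    have hvle : ∀ τ, a ≤ τ → v τ ≤ v a - c * (τ - a) := by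
      intro τ hτ
      have := mul_sub_le_of_le_hasDerivAt (fun x => (hv x).neg) (c := c) hτ fun x hx => by
        linarith [H x hx.1 (hB x hx.1)]
      simp only [Pi.neg_apply] at this
      linarith
    set τ₁ := a + (v a + 1) / c with hτ₁
    have hτ₁a : a ≤ τ₁ := by
      have : 0 < (v a + 1) / c := by positivity
      linarith
    have hneg : ∀ τ, τ₁ ≤ τ → v τ ≤ -1 := by
      intro τ hτ
      have h1 := hvle τ (hτ₁a.trans hτ)
      have h2 : c * (τ₁ - a) = v a + 1 := by
        rw [hτ₁, add_sub_cancel_left, mul_div_cancel₀ _ hc.ne']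
      nlinarith
    have hr0 : 0 < (s τ₁ - B + 1) / m := div_pos (by linarith [hB τ₁ hτ₁a]) hm
    have hfall := mul_sub_le_of_le_hasDerivAt (fun x => (hs x).neg) (c := m) (a := τ₁)
      (b := τ₁ + (s τ₁ - B + 1) / m) (by linarith) fun x hx => by
        nlinarith [hneg x hx.1]
    have h3 := hB (τ₁ + (s τ₁ - B + 1) / m) (by linarith)
    simp only [Pi.neg_apply] at hfall
    rw [add_sub_cancel_left, mul_div_cancel₀ _ hm.ne'] at hfall
    linarith
  obtain ⟨b, hb, hb0, hbpos⟩ := exists_first_zero (f := fun τ => s τ - B) (by fun_prop) hb'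
    (by linarith [hε' (a + ε) ⟨by linarith, le_rfl⟩]) (by linarith)
  have hsb : s b = B := by linarith
  have habove : ∀ σ ∈ Ioo a b, B < s σ := by
    intro σ hσ
    rcases le_total σ (a + ε) with h | h
    · exact hε' σ ⟨hσ.1, h⟩
    · linarith [hbpos σ ⟨h, hσ.2⟩]
  have hab : a < b := by linarith [hb.1]
  have hanti : StrictAntiOn v (Icc a b) :=
    strictAntiOn_of_deriv_neg (convex_Icc _ _) hvc.continuousOn fun x hx => by
      rw [interior_Icc] at hx
      rw [(hv x).deriv]
      linarith [H x hx.1.le (habove x hx).le]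
  obtain ⟨r, hr, hr0⟩ := exists_hasDerivAt_eq_zero hab hsc.continuousOn (by rw [hsa, hsb])
    fun x _ => hs x
  have hvr : v r = 0 := (mul_eq_zero.1 hr0).resolve_left hm.ne'
  refine ⟨r, b, hr.1, hr.2, hsb, hvr, fun σ hσ => ?_, fun σ hσ => ?_, habove⟩
  · rw [← hvr]
    exact hanti ⟨hσ.1, hσ.2.le.trans hr.2.le⟩ ⟨hr.1.le, hr.2.le⟩ hσ.2
  · rw [← hvr]
    exact hanti ⟨hr.1.le, hr.2.le⟩ ⟨hr.1.le.trans hσ.1.le, hσ.2⟩ hσ.1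

end

/-! ### Energy estimates: large initial velocities return -/

/-- The curve `(t, s, z)` is an integral curve of `regField m g P`. -/
structure IsRegOrbit (m : ℝ) (g P t s z : ℝ → ℝ) : Prop where
  hasDerivAt_t : ∀ τ, HasDerivAt t (g (s τ)) τ
  hasDerivAt_s : ∀ τ, HasDerivAt s (m * (z τ + P (t τ))) τ
  hasDerivAt_z : ∀ τ, HasDerivAt z (s τ) τ

section

variable {m q R : ℝ} {g P p t s z : ℝ → ℝ}

theorem IsRegOrbit.hasDerivAt_velocity (h : IsRegOrbit m g P t s z)
    (hP : ∀ t, HasDerivAt P (p t) t) (τ : ℝ) :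
    HasDerivAt (fun τ => z τ + P (t τ)) (s τ + p (t τ) * g (s τ)) τ :=
  (h.hasDerivAt_z τ).add ((hP (t τ)).comp τ (h.hasDerivAt_t τ))

theorem cutoffPow_nonneg (hq : 1 < q) {x : ℝ} (hx : 0 ≤ x) : 0 ≤ cutoffPow q R x :=
  intervalIntegral.integral_nonneg hx fun σ _ => by
    have h0 : (0 : ℝ) ≤ max 0 (min σ R) := le_max_left _ _
    positivity

/-- The antiderivative of `(q + 1) • cutoffPow q R`, equal to `s ^ (q + 1)` on `[0, R]`. -/
noncomputable def cutoffPrimitive (q R s : ℝ) : ℝ := ∫ σ in (0 : ℝ)..s, (q + 1) * cutoffPow q R σ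

theorem hasDerivAt_cutoffPrimitive (hq : 1 < q) (x : ℝ) :
    HasDerivAt (cutoffPrimitive q R) ((q + 1) * cutoffPow q R x) x := by
  have hc : Continuous fun σ => (q + 1) * cutoffPow q R σ :=
    continuous_const.mul (continuous_of_forall_hasDerivAt (hasDerivAt_cutoffPow hq R))
  exact intervalIntegral.integral_hasDerivAt_right (hc.intervalIntegrable _ _)
    (hc.stronglyMeasurableAtFilter _ _) hc.continuousAt

theorem cutoffPrimitive_eq (hq : 1 < q) {x : ℝ} (hx : 0 ≤ x) (hxR : x ≤ R) :
    cutoffPrimitive q R x = x ^ (q + 1) := by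
  have h1 : cutoffPrimitive q R x = ∫ σ in (0 : ℝ)..x, (q + 1) * σ ^ q := by
    apply intervalIntegral.integral_congr
    intro σ hσ
    rw [uIcc_of_le hx] at hσ
    simp only
    rw [cutoffPow_eq hq hσ.1 (hσ.2.trans hxR)]
  rw [h1, intervalIntegral.integral_const_mul, integral_rpow (Or.inl (by linarith)),
    Real.zero_rpow (by linarith)]
  field_simp
  ring

/-- Above a level `B ≤ R` the cut-off power dominates the linear function `B ^ (q - 1) s`. -/
theorem mul_le_cutoffPow (hq : 1 < q) {B : ℝ} (hB : 0 < B) (hBR : B ≤ R) {x : ℝ} (hx : B ≤ x) :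
    B ^ (q - 1) * x ≤ cutoffPow q R x := by
  have h1 := mul_sub_le_of_le_hasDerivAt (hasDerivAt_cutoffPow hq R) (c := B ^ (q - 1)) hx
    fun y hy => by
      have h2 : B ≤ max 0 (min y R) := le_max_of_le_right (le_min hy.1 hBR)
      have h3 : B ^ (q - 1) ≤ (max 0 (min y R)) ^ (q - 1) :=
        Real.rpow_le_rpow hB.le h2 (by linarith)
      have h4 : (0 : ℝ) ≤ B ^ (q - 1) := by positivity
      unfold cutoffPowDeriv
      nlinarith
  rw [cutoffPow_eq hq hB.le hBR] at h1
  have h5 : B ^ (q - 1) * B = B ^ q := by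
    rw [← Real.rpow_add_one hB.ne', sub_add_cancel]
  linarith

/-- The energy relation: the rate of `v² / 2 - s² / (2 m) - c Q`, where `Q' = g / m`. -/
theorem IsRegOrbit.hasDerivAt_energy (hm : 0 < m) (hq : 1 < q) (hmq : m * (q + 1) = 1)
    (h : IsRegOrbit m (cutoffPow q R) P t s z) (hP : ∀ t, HasDerivAt P (p t) t) (c τ : ℝ) :
    HasDerivAt (fun τ => (z τ + P (t τ)) ^ 2 / 2 - s τ ^ 2 / (2 * m)
        - c * cutoffPrimitive q R (s τ))
      ((p (t τ) - c) * cutoffPow q R (s τ) * (z τ + P (t τ))) τ := by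
  have h1 := (((h.hasDerivAt_velocity hP τ).pow 2).div_const 2).sub
    (((h.hasDerivAt_s τ).pow 2).div_const (2 * m))
  have h2 := h1.sub (((hasDerivAt_cutoffPrimitive (R := R) hq (s τ)).comp τ
    (h.hasDerivAt_s τ)).const_mul c)
  refine h2.congr_deriv ?_
  have h3 : q + 1 = 1 / m := by field_simp; linarith
  rw [h3]
  field_simp
  push_cast
  ring

/-- Orbits that leave `s = 0` with sufficiently large velocity come back to `s = 0`. The level
`B` is the height of the zero-energy turning point for the constant forcing `p₁`: below `B` the
energy excludes turning around on the way up or down, above `B` the velocity decreases at a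
definite rate. -/
theorem IsRegOrbit.exists_return (hm : 0 < m) (hq : 1 < q) (hmq : m * (q + 1) = 1)
    {p₁ p₂ : ℝ} (hb : ∀ t, p₂ ≤ p t ∧ p t ≤ p₁) (hP : ∀ t, HasDerivAt P (p t) t)
    {B : ℝ} (hB : 0 < B) (hBq : -p₁ * B ^ (q - 1) * (2 * m) = 1) (hm2 : 2 * m < 1)
    (hBR : B < R) {v₀ : ℝ} (hR : v₀ ^ 2 / 2 + R ^ 2 / (2 * m) + p₁ * R ^ (q + 1) < 0)
    (hv₀ : 0 < v₀) (hv₀' : 2 * (p₁ - p₂) * B ^ (q + 1) < v₀ ^ 2)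
    (h : IsRegOrbit m (cutoffPow q R) P t s z) (hs0 : s 0 = 0) (hv0 : z 0 + P (t 0) = v₀) :
    ∃ T > 0, s T = 0 ∧ z T + P (t T) < 0 ∧ ∀ τ ∈ Ioo 0 T, 0 < s τ ∧ s τ < R := by
  set v : ℝ → ℝ := fun τ => z τ + P (t τ) with hvdef
  have hvd := h.hasDerivAt_velocity hP
  have hvc : Continuous v := continuous_of_forall_hasDerivAt hvd
  have hsd : ∀ τ, HasDerivAt s (m * v τ) τ := h.hasDerivAt_s
  have hsc : Continuous s := continuous_of_forall_hasDerivAt hsd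
  have hE : ∀ c τ, HasDerivAt (fun τ => v τ ^ 2 / 2 - s τ ^ 2 / (2 * m)
        - c * cutoffPrimitive q R (s τ)) ((p (t τ) - c) * cutoffPow q R (s τ) * v τ) τ :=
    h.hasDerivAt_energy hm hq hmq hP
  have hp₁ : p₁ < 0 := by
    by_contra! hcon
    have : 0 ≤ p₁ * B ^ (q - 1) * (2 * m) := by positivity
    linarith
  have hprim0 : cutoffPrimitive q R 0 = 0 := by simp [cutoffPrimitive]
  -- below `B` the potential of the constant forcing `p₁` is nonnegative
  have hpot : ∀ x, 0 ≤ x → x ≤ B → 0 ≤ x ^ 2 / (2 * m) + p₁ * x ^ (q + 1) := by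
    intro x hx hxB
    have e1 : x ^ (q + 1) = x ^ 2 * x ^ (q - 1) := by
      rcases hx.eq_or_lt with h0 | h0
      · rw [← h0, Real.zero_rpow (by linarith)]
        simp
      · rw [← Real.rpow_natCast x 2, ← Real.rpow_add h0]
        congr 1
        push_cast
        ring
    have e2 : x ^ (q - 1) ≤ B ^ (q - 1) := Real.rpow_le_rpow hx hxB (by linarith)
    have e3 : 1 / (2 * m) = -p₁ * B ^ (q - 1) := by
      field_simp
      linarith
    have e4 : x ^ 2 / (2 * m) = x ^ 2 * (-p₁ * B ^ (q - 1)) := by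
      rw [← e3]
      ring
    rw [e1, e4]
    have : 0 ≤ x ^ 2 * (-p₁) * (B ^ (q - 1) - x ^ (q - 1)) :=
      mul_nonneg (mul_nonneg (sq_nonneg x) (by linarith)) (by linarith)
    linarith
  have hpotB : B ^ 2 / (2 * m) + p₁ * B ^ (q + 1) = 0 := by
    have e1 : B ^ (q + 1) = B ^ 2 * B ^ (q - 1) := by
      rw [← Real.rpow_natCast B 2, ← Real.rpow_add hB]
      congr 1
      push_cast
      ring
    rw [e1]
    field_simp
    linear_combination (-(B ^ 2)) * hBq
  have hv00 : v 0 = v₀ := hv0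
  -- on the way up the energy for the forcing `p₂` does not decrease
  set c : ℝ := Real.sqrt (v₀ ^ 2 - 2 * (p₁ - p₂) * B ^ (q + 1)) with hc
  have hcpos : 0 < c := Real.sqrt_pos.2 (by linarith)
  obtain ⟨τ₁, hτ₁, hsτ₁, hvτ₁, hlt₁⟩ := exists_crossing hm hsd hvc (a := 0) (B := B) (c := c)
    (by rw [hs0]; exact hB) (by rw [hv00]; exact hv₀.le) hcpos (by
      intro τ hτ hσ
      have hmono := monotoneOn_Icc_of_hasDerivAt_nonneg hsd (a := 0) (b := τ) fun x hx =>
        mul_nonneg hm.le (hσ x hx).1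
      have hs_nonneg : ∀ x ∈ Icc 0 τ, 0 ≤ s x := fun x hx => by
        rw [← hs0]
        exact hmono ⟨le_rfl, hτ⟩ hx hx.1
      have hEm := monotoneOn_Icc_of_hasDerivAt_nonneg (hE p₂) (a := 0) (b := τ) (fun x hx =>
        mul_nonneg (mul_nonneg (by linarith [(hb (t x)).1]) (cutoffPow_nonneg hq (hs_nonneg x hx)))
          (hσ x hx).1) ⟨le_rfl, hτ⟩ ⟨hτ, le_rfl⟩ hτ
      have hτI : τ ∈ Icc 0 τ := ⟨hτ, le_rfl⟩
      have hs1 := hs_nonneg τ hτI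
      have hs2 := (hσ τ hτI).2
      simp only at hEm
      rw [hs0, hprim0, hv00, cutoffPrimitive_eq hq hs1 (hs2.trans hBR.le)] at hEm
      have h1 := hpot (s τ) hs1 hs2
      have h2 : s τ ^ (q + 1) ≤ B ^ (q + 1) := Real.rpow_le_rpow hs1 hs2 (by linarith)
      have h3 : 0 ≤ p₁ - p₂ := by linarith [(hb 0).1, (hb 0).2]
      have h4 := mul_le_mul_of_nonneg_left h2 h3
      apply Real.sqrt_le_iff.2 ⟨(hσ τ hτI).1, _⟩
      norm_num at hEm
      linarith)
  have hvp₁ : ∀ τ, τ₁ ≤ τ → B ≤ s τ → s τ + p (t τ) * cutoffPow q R (s τ) ≤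
      -(B * (1 / (2 * m) - 1)) := by
    intro τ _ hsB
    have h1 := mul_le_cutoffPow hq hB hBR.le hsB
    have h2 : p (t τ) * cutoffPow q R (s τ) ≤ p₁ * (B ^ (q - 1) * s τ) := by
      calc p (t τ) * cutoffPow q R (s τ) ≤ p₁ * cutoffPow q R (s τ) := by
            gcongr
            · exact cutoffPow_nonneg hq (hB.le.trans hsB)
            · exact (hb _).2
        _ ≤ p₁ * (B ^ (q - 1) * s τ) := mul_le_mul_of_nonpos_left h1 hp₁.le
    have h3 : p₁ * B ^ (q - 1) = -(1 / (2 * m)) := by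
      field_simp
      linarith
    have h4 : 0 < 1 / (2 * m) - 1 := by
      rw [sub_pos, lt_div_iff₀ (by positivity)]
      linarith
    rw [← mul_assoc, h3] at h2
    nlinarith
  obtain ⟨r, τ₂, hr₁, hr₂, hsτ₂, hvr, hvup, hvdown, habove⟩ := exists_turning_return hm hsd hvd hsτ₁
    (hvτ₁ τ₁ ⟨hτ₁.le, le_rfl⟩)
    (c := B * (1 / (2 * m) - 1)) (by
      have h4 : 0 < 1 / (2 * m) - 1 := by
        rw [sub_pos, lt_div_iff₀ (by positivity)]
        linarith
      positivity) hvp₁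
  have hv_up : ∀ σ ∈ Icc 0 r, 0 ≤ v σ := by
    intro σ hσ
    rcases le_total σ τ₁ with h1 | h1
    · exact (hvτ₁ σ ⟨hσ.1, h1⟩).le
    · rcases hσ.2.eq_or_lt with h2 | h2
      · rw [h2]
        exact hvr.ge
      · exact (hvup σ ⟨h1, h2⟩).le
  have hr0 : 0 < r := hτ₁.trans hr₁
  have hmono := monotoneOn_Icc_of_hasDerivAt_nonneg hsd (a := 0) (b := r) fun x hx =>
    mul_nonneg hm.le (hv_up x hx)
  have hs_up : ∀ x ∈ Icc 0 r, 0 ≤ s x := fun x hx => by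
    rw [← hs0]
    exact hmono ⟨le_rfl, hr0.le⟩ hx hx.1
  -- on the way up the energy for the forcing `p₁` does not increase, so `s` cannot reach `R`
  have hsR : ∀ x ∈ Icc 0 r, s x < R := by
    intro x hx
    by_contra! hcon
    obtain ⟨y, hy, hyR⟩ := intermediate_value_Icc hx.1 hsc.continuousOn
      (show R ∈ Icc (s 0) (s x) from ⟨by rw [hs0]; exact hB.le.trans hBR.le, hcon⟩)
    have hyr : y ≤ r := hy.2.trans hx.2
    have hEm := antitoneOn_Icc_of_hasDerivAt_nonpos (hE p₁) (a := 0) (b := y) (fun w hw => by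
      have hw' : w ∈ Icc 0 r := ⟨hw.1, hw.2.trans hyr⟩
      exact mul_nonpos_of_nonpos_of_nonneg (mul_nonpos_of_nonpos_of_nonneg
        (by linarith [(hb (t w)).2]) (cutoffPow_nonneg hq (hs_up w hw'))) (hv_up w hw'))
      ⟨le_rfl, hy.1⟩ ⟨hy.1, le_rfl⟩ hy.1
    simp only at hEm
    rw [hs0, hprim0, hv00, hyR, cutoffPrimitive_eq hq (hB.le.trans hBR.le) le_rfl] at hEm
    norm_num at hEm
    nlinarith [sq_nonneg (v y)]
  have hanti := antitoneOn_Icc_of_hasDerivAt_nonpos hsd (a := r) (b := τ₂) fun x hx => by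
    rcases hx.1.eq_or_lt with h1 | h1
    · rw [← h1, hvr, mul_zero]
    · exact (mul_neg_of_pos_of_neg hm (hvdown x ⟨h1, hx.2⟩)).le
  have hvτ₂ : v τ₂ < 0 := hvdown τ₂ ⟨hr₂, le_rfl⟩
  have hτ₂ : 0 < τ₂ := hr0.trans hr₂
  -- on the way down below `B` the energy for the forcing `p₁` does not decrease
  obtain ⟨T, hT, hsT, hvT, hltT⟩ := exists_crossing (s := fun τ => -s τ) (v := fun τ => -v τ)
    (a := τ₂) (B := 0) (c := -v τ₂) hm (fun τ => by simpa using! (hsd τ).neg) hvc.neg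
    (by rw [hsτ₂]; linarith) (by linarith) (by linarith) (by
      intro τ hτ hσ
      have hanti' := antitoneOn_Icc_of_hasDerivAt_nonpos hsd (a := τ₂) (b := τ) fun x hx =>
        mul_nonpos_of_nonneg_of_nonpos hm.le (by linarith [(hσ x hx).1])
      have hEm := monotoneOn_Icc_of_hasDerivAt_nonneg (hE p₁) (a := τ₂) (b := τ) (fun x hx =>
        mul_nonneg_of_nonpos_of_nonpos (mul_nonpos_of_nonpos_of_nonneg
          (by linarith [(hb (t x)).2])
          (cutoffPow_nonneg hq (by linarith [(hσ x hx).2]))) (by linarith [(hσ x hx).1]))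
        ⟨le_rfl, hτ⟩ ⟨hτ, le_rfl⟩ hτ
      have hτI : τ ∈ Icc τ₂ τ := ⟨hτ, le_rfl⟩
      have hs1 : 0 ≤ s τ := by linarith [(hσ τ hτI).2]
      have hs2 : s τ ≤ B := by
        rw [← hsτ₂]
        exact hanti' ⟨le_rfl, hτ⟩ hτI hτ
      simp only at hEm
      rw [hsτ₂, cutoffPrimitive_eq hq hB.le hBR.le, cutoffPrimitive_eq hq hs1
        (hs2.trans hBR.le)] at hEm
      have h1 := hpot (s τ) hs1 hs2
      refine abs_le_of_sq_le_sq' ?_ (hσ τ hτI).1 |>.2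
      nlinarith)
  have hT0 : 0 < T := hτ₂.trans hT
  refine ⟨T, hT0, by linarith, by linarith [hvT T ⟨hT.le, le_rfl⟩], fun τ hτ => ?_⟩
  rcases le_or_gt τ r with h1 | h1
  · refine ⟨?_, hsR τ ⟨hτ.1.le, h1⟩⟩
    rcases le_or_gt τ τ₁ with h2 | h2
    · have : StrictMonoOn s (Icc 0 τ₁) :=
        strictMonoOn_of_deriv_pos (convex_Icc _ _) hsc.continuousOn fun x hx => by
          rw [(hsd x).deriv]
          exact mul_pos hm (hvτ₁ x (interior_subset hx))
      rw [← hs0]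
      exact this ⟨le_rfl, hτ₁.le⟩ ⟨hτ.1.le, h2⟩ hτ.1
    · exact hB.trans (habove τ ⟨h2, h1.trans_lt hr₂⟩)
  · rcases lt_or_ge τ τ₂ with h2 | h2
    · refine ⟨hB.trans (habove τ ⟨hr₁.trans h1, h2⟩), ?_⟩
      exact (hanti ⟨le_rfl, hr₂.le⟩ ⟨h1.le, h2.le⟩ h1.le).trans_lt (hsR r ⟨hr0.le, le_rfl⟩)
    · refine ⟨by linarith [hltT τ ⟨h2, hτ.2⟩], ?_⟩
      have hanti' := antitoneOn_Icc_of_hasDerivAt_nonpos hsd (a := τ₂) (b := τ) fun x hx =>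
        mul_nonpos_of_nonneg_of_nonpos hm.le (by linarith [hvT x ⟨hx.1, hx.2.trans hτ.2.le⟩])
      have := hanti' ⟨le_rfl, h2⟩ ⟨h2, le_rfl⟩ h2
      rw [hsτ₂] at this
      exact this.trans_lt hBR

end

/-! ### From regularised orbits to solutions of the singular equation -/

section

variable {m q R α : ℝ} {P p t s z : ℝ → ℝ}

/-- An orbit of the regularised field between two consecutive visits to `s = 0` is, with the old
time `t` as independent variable, a positive solution between two consecutive singularities. -/
theorem IsRegOrbit.isSuccessor (hq : 1 < q) (hmq : m * (q + 1) = 1)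
    (hα : q - 1 = (q + 1) * α)
    (hP : ∀ t, HasDerivAt P (p t) t) (h : IsRegOrbit m (cutoffPow q R) P t s z) {T : ℝ}
    (hT : 0 < T) (hs0 : s 0 = 0) (hsT : s T = 0) (hpos : ∀ τ ∈ Ioo 0 T, 0 < s τ ∧ s τ < R) :
    IsSuccessor α p (t 0, z 0 + P (t 0)) (t T, -(z T + P (t T))) := by
  have hvd := h.hasDerivAt_velocity hP
  have hvc := continuous_of_forall_hasDerivAt hvd
  have hsc := continuous_of_forall_hasDerivAt h.hasDerivAt_s
  have htc := continuous_of_forall_hasDerivAt h.hasDerivAt_t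
  have hg : ∀ τ ∈ Ioo 0 T, cutoffPow q R (s τ) = s τ ^ q := fun τ hτ =>
    cutoffPow_eq hq (hpos τ hτ).1.le (hpos τ hτ).2.le
  have hgpos : ∀ τ ∈ Ioo 0 T, 0 < s τ ^ q := fun τ hτ => Real.rpow_pos_of_pos (hpos τ hτ).1 q
  have hmono : StrictMonoOn t (Icc 0 T) :=
    strictMonoOn_of_deriv_pos (convex_Icc _ _) htc.continuousOn fun x hx => by
      rw [interior_Icc] at hx
      rw [(h.hasDerivAt_t x).deriv, hg x hx]
      exact hgpos x hx
  have h0I : (0 : ℝ) ∈ Icc 0 T := ⟨le_rfl, hT.le⟩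
  have hTI : T ∈ Icc 0 T := ⟨hT.le, le_rfl⟩
  have ht0T : t 0 < t T := hmono h0I hTI hT
  have hex : ∀ y ∈ Ioo (t 0) (t T), ∃ τ ∈ Ioo 0 T, t τ = y := fun y hy =>
    intermediate_value_Ioo hT.le htc.continuousOn hy
  -- the inverse of the time change
  set θ : ℝ → ℝ := Function.invFunOn t (Ioo 0 T)
  have hθ : ∀ y ∈ Ioo (t 0) (t T), θ y ∈ Ioo 0 T ∧ t (θ y) = y := fun y hy =>
    Function.invFunOn_pos (hex y hy)
  have hmap : ∀ τ ∈ Ioo 0 T, t τ ∈ Ioo (t 0) (t T) := fun τ hτ =>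
    ⟨hmono h0I ⟨hτ.1.le, hτ.2.le⟩ hτ.1, hmono ⟨hτ.1.le, hτ.2.le⟩ hTI hτ.2⟩
  have hθt : ∀ τ ∈ Ioo 0 T, θ (t τ) = τ := fun τ hτ => by
    have := hθ _ (hmap τ hτ)
    exact hmono.injOn (Ioo_subset_Icc_self this.1) (Ioo_subset_Icc_self hτ) this.2
  have hθmono : StrictMonoOn θ (Ioo (t 0) (t T)) := by
    intro y hy y' hy' hyy
    have h1 := hθ y hy
    have h2 := hθ y' hy'
    by_contra! hcon
    have := hmono.monotoneOn (Ioo_subset_Icc_self h2.1) (Ioo_subset_Icc_self h1.1) hcon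
    rw [h1.2, h2.2] at this
    linarith
  have hθc : ∀ y ∈ Ioo (t 0) (t T), ContinuousAt θ y := by
    intro y hy
    refine hθmono.continuousAt_of_image_mem_nhds (Ioo_mem_nhds hy.1 hy.2) ?_
    have h1 := (hθ y hy).1
    refine mem_of_superset (Ioo_mem_nhds h1.1 h1.2) fun τ hτ => ⟨t τ, hmap τ hτ, hθt τ hτ⟩
  have hθd : ∀ y ∈ Ioo (t 0) (t T), HasDerivAt θ (s (θ y) ^ q)⁻¹ y := by
    intro y hy
    have h1 := h.hasDerivAt_t (θ y)
    rw [hg _ (hθ y hy).1] at h1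
    refine HasDerivAt.of_local_left_inverse (hθc y hy) h1 (hgpos _ (hθ y hy).1).ne' ?_
    filter_upwards [Ioo_mem_nhds hy.1 hy.2] with y' hy' using (hθ y' hy').2
  have hq1 : (0 : ℝ) < q + 1 := by linarith
  have hud : ∀ y ∈ Ioo (t 0) (t T), HasDerivAt (fun y => s (θ y) ^ (q + 1))
      (z (θ y) + P (t (θ y))) y := by
    intro y hy
    have hspos := (hpos _ (hθ y hy).1).1
    have h1 := ((h.hasDerivAt_s (θ y)).comp y (hθd y hy)).rpow_const (p := q + 1)
      (Or.inl hspos.ne')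
    refine h1.congr_deriv ?_
    have h2 := (hgpos _ (hθ y hy).1).ne'
    simp only [Function.comp_apply, add_sub_cancel_right]
    field_simp
    linear_combination (z (θ y) + P (t (θ y))) * hmq
  have hderiv : ∀ y ∈ Ioo (t 0) (t T), deriv (fun y => s (θ y) ^ (q + 1)) y =
      z (θ y) + P (t (θ y)) := fun y hy => (hud y hy).deriv
  have hlim0 : Tendsto θ (𝓝[>] (t 0)) (𝓝 0) := by
    refine tendsto_order.2 ⟨fun a ha => ?_, fun a ha => ?_⟩
    · filter_upwards [Ioo_mem_nhdsGT ht0T] with y hy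
      exact ha.trans (hθ y hy).1.1
    · have hb : min a (T / 2) ∈ Ioo 0 T :=
        ⟨lt_min ha (by linarith), (min_le_right _ _).trans_lt (by linarith)⟩
      filter_upwards [Ioo_mem_nhdsGT (hmap _ hb).1] with y hy
      have hy' : y ∈ Ioo (t 0) (t T) := ⟨hy.1, hy.2.trans (hmap _ hb).2⟩
      have := hθmono hy' (hmap _ hb) hy.2
      rw [hθt _ hb] at this
      exact this.trans_le (min_le_left _ _)
  have hlimT : Tendsto θ (𝓝[<] (t T)) (𝓝 T) := by
    refine tendsto_order.2 ⟨fun a ha => ?_, fun a ha => ?_⟩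
    · have hb : max a (T / 2) ∈ Ioo 0 T :=
        ⟨lt_max_of_lt_right (by linarith), max_lt ha (by linarith)⟩
      filter_upwards [Ioo_mem_nhdsLT (hmap _ hb).2] with y hy
      have hy' : y ∈ Ioo (t 0) (t T) := ⟨(hmap _ hb).1.trans hy.1, hy.2⟩
      have := hθmono (hmap _ hb) hy' hy.1
      rw [hθt _ hb] at this
      exact (le_max_left _ _).trans_lt this
    · filter_upwards [Ioo_mem_nhdsLT ht0T] with y hy
      exact (hθ y hy).1.2.trans ha
  have hu_lim : ∀ τ, s τ = 0 → ∀ l : Filter ℝ, Tendsto θ l (𝓝 τ) →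
      Tendsto (fun y => s (θ y) ^ (q + 1)) l (𝓝 0) := by
    intro τ hτ l hl
    have h1 := ((hsc.tendsto τ).comp hl).rpow_const (p := q + 1) (Or.inr hq1.le)
    rwa [hτ, Real.zero_rpow hq1.ne'] at h1
  refine ⟨ht0T, fun y => s (θ y) ^ (q + 1), fun y hy => ?_, hu_lim 0 hs0 _ hlim0, ?_,
    hu_lim T hsT _ hlimT, ?_⟩
  · have hspos := (hpos _ (hθ y hy).1).1
    refine ⟨Real.rpow_pos_of_pos hspos _, (hud y hy).differentiableAt, ?_⟩
    have hev : deriv (fun y => s (θ y) ^ (q + 1)) =ᶠ[𝓝 y] fun y => z (θ y) + P (t (θ y)) := by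
      filter_upwards [Ioo_mem_nhds hy.1 hy.2] with y' hy' using hderiv y' hy'
    refine HasDerivAt.congr_of_eventuallyEq ?_ hev
    refine ((hvd (θ y)).comp y (hθd y hy)).congr_deriv ?_
    rw [hg _ (hθ y hy).1, (hθ y hy).2, ← Real.rpow_mul hspos.le, ← hα,
      Real.rpow_sub_one hspos.ne']
    have h2 := (hgpos _ (hθ y hy).1).ne'
    field_simp
  · refine Tendsto.congr' ?_ ((hvc.tendsto 0).comp hlim0)
    filter_upwards [Ioo_mem_nhdsGT ht0T] with y hy
    exact (hderiv y hy).symm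
  · simp only [neg_neg]
    refine Tendsto.congr' ?_ ((hvc.tendsto T).comp hlimT)
    filter_upwards [Ioo_mem_nhdsLT ht0T] with y hy
    exact (hderiv y hy).symm

end

/-! ### Uniqueness and time reversal -/

section

variable {α : ℝ} {p u u₁ u₂ : ℝ → ℝ} {t₀ b v₀ : ℝ}

theorem abs_one_div_rpow_sub_le (hα : 0 < α) {κ x y : ℝ} (hκ : 0 < κ) (hx : κ ≤ x) (hy : κ ≤ y) :
    |1 / x ^ α - 1 / y ^ α| ≤ α * κ ^ (-α - 1) * |x - y| := by
  have h := (convex_Ici κ).norm_image_sub_le_of_norm_hasDerivWithin_le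
    (f := fun r : ℝ => r ^ (-α)) (f' := fun r => -α * r ^ (-α - 1)) (C := α * κ ^ (-α - 1))
    (x := y) (y := x) (fun r hr => (Real.hasDerivAt_rpow_const
      (Or.inl (hκ.trans_le hr).ne')).hasDerivWithinAt) (fun r hr => ?_) hy hx
  · simpa [Real.rpow_neg (hκ.le.trans hx), Real.rpow_neg (hκ.le.trans hy)] using h
  · have hr0 : 0 < r := hκ.trans_le hr
    rw [norm_mul, norm_neg, Real.norm_of_nonneg hα.le, Real.norm_of_nonneg (by positivity)]
    gcongr ?_ * ?_
    exact Real.rpow_le_rpow_of_nonpos hκ hr (by linarith)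

theorem abs_le_of_abs_deriv_le {f f' : ℝ → ℝ} {M : ℝ} (hf : ∀ t ∈ Ioo t₀ b, HasDerivAt f (f' t) t)
    (h0 : Tendsto f (𝓝[>] t₀) (𝓝 0)) (hM : ∀ t ∈ Ioo t₀ b, |f' t| ≤ M) {t : ℝ}
    (ht : t ∈ Ioo t₀ b) : |f t| ≤ M * (t - t₀) := by
  have h1 : ∀ᶠ a in 𝓝[>] t₀, |f t - f a| ≤ M * (t - a) := by
    filter_upwards [Ioo_mem_nhdsGT ht.1] with a ha
    have hsub : Icc a t ⊆ Ioo t₀ b := fun x hx => ⟨ha.1.trans_le hx.1, hx.2.trans_lt ht.2⟩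
    have := (convex_Icc a t).norm_image_sub_le_of_norm_hasDerivWithin_le (f := f) (f' := f')
      (C := M) (fun x hx => (hf x (hsub hx)).hasDerivWithinAt) (fun x hx => hM x (hsub hx))
      (⟨le_rfl, ha.2.le⟩ : a ∈ Icc a t) ⟨ha.2.le, le_rfl⟩
    rwa [Real.norm_eq_abs, Real.norm_eq_abs, abs_of_nonneg (by linarith [ha.2] : 0 ≤ t - a)] at this
  have h2 : Tendsto (fun a => |f t - f a|) (𝓝[>] t₀) (𝓝 |f t - 0|) :=
    (tendsto_const_nhds.sub h0).abs
  have h3 : Tendsto (fun a => M * (t - a)) (𝓝[>] t₀) (𝓝 (M * (t - t₀))) :=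
    (((continuous_const.sub continuous_id).const_mul M).tendsto t₀).mono_left nhdsWithin_le_nhds
  rw [sub_zero] at h2
  exact le_of_tendsto_of_tendsto h2 h3 h1

/-- If a function vanishing at the left end of an interval has a derivative dominated by that of a
nonnegative function, it is dominated by that function. -/
theorem abs_le_of_abs_deriv_le_deriv {f f' φ φ' : ℝ → ℝ}
    (hf : ∀ t ∈ Ioo t₀ b, HasDerivAt f (f' t) t) (hφ : ∀ t ∈ Ioo t₀ b, HasDerivAt φ (φ' t) t)
    (hφ0 : ∀ t ∈ Ioo t₀ b, 0 ≤ φ t) (h0 : Tendsto f (𝓝[>] t₀) (𝓝 0))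
    (hM : ∀ t ∈ Ioo t₀ b, |f' t| ≤ φ' t) {t : ℝ} (ht : t ∈ Ioo t₀ b) : |f t| ≤ φ t := by
  have h1 : ∀ᶠ a in 𝓝[>] t₀, |f t - f a| ≤ φ t := by
    filter_upwards [Ioo_mem_nhdsGT ht.1] with a ha
    have hsub : Icc a t ⊆ Ioo t₀ b := fun x hx => ⟨ha.1.trans_le hx.1, hx.2.trans_lt ht.2⟩
    have hmono : ∀ h h' : ℝ → ℝ, (∀ x ∈ Icc a t, HasDerivAt h (h' x) x) →
        (∀ x ∈ Icc a t, 0 ≤ h' x) → h a ≤ h t := by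
      intro h h' hh hh'
      refine monotoneOn_of_deriv_nonneg (convex_Icc a t)
        (fun x hx => (hh x hx).continuousAt.continuousWithinAt)
        (fun x hx => (hh x (interior_subset hx)).differentiableAt.differentiableWithinAt)
        (fun x hx => ?_) ⟨le_rfl, ha.2.le⟩ ⟨ha.2.le, le_rfl⟩ ha.2.le
      rw [(hh x (interior_subset hx)).deriv]
      exact hh' x (interior_subset hx)
    have ha0 := hφ0 a ⟨ha.1, ha.2.trans ht.2⟩
    have e1 := hmono _ _ (fun x hx => (hφ x (hsub hx)).sub (hf x (hsub hx))) fun x hx => by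
      linarith [(abs_le.1 (hM x (hsub hx))).2]
    have e2 := hmono _ _ (fun x hx => (hφ x (hsub hx)).add (hf x (hsub hx))) fun x hx => by
      linarith [(abs_le.1 (hM x (hsub hx))).1]
    simp only [Pi.sub_apply, Pi.add_apply] at e1 e2
    rw [abs_le]
    constructor <;> linarith
  have h2 : Tendsto (fun a => |f t - f a|) (𝓝[>] t₀) (𝓝 |f t - 0|) :=
    (tendsto_const_nhds.sub h0).abs
  rw [sub_zero] at h2
  exact le_of_tendsto h2 h1

/-- Two solutions leaving the singularity with the same positive velocity agree near it. The force
`1 / u ^ α` is not Lipschitz there, but as both solutions grow at least linearly, a bound `M` for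
the difference of the velocities near `t₀` improves to `M / 2`. -/
theorem exists_eqOn_deriv_of_start (hα₀ : 0 < α) (hα₁ : α < 1) (hb : t₀ < b) (hv₀ : 0 < v₀)
    (h₁ : IsClassicalSolutionOn α p u₁ (Ioo t₀ b)) (h₂ : IsClassicalSolutionOn α p u₂ (Ioo t₀ b))
    (hu₁ : Tendsto u₁ (𝓝[>] t₀) (𝓝 0)) (hu₂ : Tendsto u₂ (𝓝[>] t₀) (𝓝 0))
    (hd₁ : Tendsto (deriv u₁) (𝓝[>] t₀) (𝓝 v₀)) (hd₂ : Tendsto (deriv u₂) (𝓝[>] t₀) (𝓝 v₀)) :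
    ∃ b' ∈ Ioc t₀ b, ∀ t ∈ Ioo t₀ b', u₁ t = u₂ t ∧ deriv u₁ t = deriv u₂ t := by
  set c : ℝ := v₀ / 2 with hc
  have hcpos : 0 < c := by positivity
  set A : ℝ := α * c ^ (-α - 1) / (1 - α) with hA
  have h1α : 0 < 1 - α := by linarith
  have hApos : 0 < A := by positivity
  have hd : Tendsto (fun t => deriv u₁ t - deriv u₂ t) (𝓝[>] t₀) (𝓝 0) := by
    simpa using hd₁.sub hd₂
  have hD : Tendsto (fun t => u₁ t - u₂ t) (𝓝[>] t₀) (𝓝 0) := by simpa using hu₁.sub hu₂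
  have hsm : Tendsto (fun t => A * (t - t₀) ^ (1 - α)) (𝓝[>] t₀) (𝓝 0) := by
    have : Tendsto (fun t => A * (t - t₀) ^ (1 - α)) (𝓝 t₀) (𝓝 (A * (t₀ - t₀) ^ (1 - α))) :=
      (((continuous_id.sub continuous_const).rpow_const fun _ => Or.inr h1α.le).const_mul
        A).tendsto t₀
    rw [sub_self, Real.zero_rpow h1α.ne', mul_zero] at this
    exact this.mono_left nhdsWithin_le_nhds
  have hev : ∀ᶠ t in 𝓝[>] t₀, (c < deriv u₁ t ∧ c < deriv u₂ t) ∧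
      |deriv u₁ t - deriv u₂ t| < 1 ∧ A * (t - t₀) ^ (1 - α) < 1 / 2 := by
    have hcv : c < v₀ := by linarith
    have habs := hd.abs
    rw [abs_zero] at habs
    exact ((hd₁.eventually (lt_mem_nhds hcv)).and (hd₂.eventually (lt_mem_nhds hcv))).and
      ((habs.eventually (gt_mem_nhds one_pos)).and (hsm.eventually (gt_mem_nhds (by norm_num))))
  obtain ⟨b₁, hb₁, hsub₁⟩ := mem_nhdsGT_iff_exists_Ioo_subset.1 hev
  have hb₁' : t₀ < b₁ := hb₁
  set b' := min b b₁ with hb'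
  have hIb : Ioo t₀ b' ⊆ Ioo t₀ b := Ioo_subset_Ioo_right (min_le_left _ _)
  have hIe : Ioo t₀ b' ⊆ Ioo t₀ b₁ := Ioo_subset_Ioo_right (min_le_right _ _)
  have hlow : ∀ u : ℝ → ℝ, IsClassicalSolutionOn α p u (Ioo t₀ b) → Tendsto u (𝓝[>] t₀) (𝓝 0) →
      (∀ t ∈ Ioo t₀ b', c < deriv u t) → ∀ t ∈ Ioo t₀ b', c * (t - t₀) ≤ u t := by
    intro u hu hlim hder t ht
    have h1 : ∀ᶠ a in 𝓝[>] t₀, c * (t - a) ≤ u t - u a := by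
      filter_upwards [Ioo_mem_nhdsGT ht.1] with a ha
      have hsub : Icc a t ⊆ Ioo t₀ b' := fun x hx => ⟨ha.1.trans_le hx.1, hx.2.trans_lt ht.2⟩
      exact (convex_Icc a t).mul_sub_le_image_sub_of_le_deriv
        (fun x hx => (hu x (hIb (hsub hx))).2.1.continuousAt.continuousWithinAt)
        (fun x hx => (hu x (hIb (hsub (interior_subset hx)))).2.1.differentiableWithinAt)
        (fun x hx => (hder x (hsub (interior_subset hx))).le)
        a ⟨le_rfl, ha.2.le⟩ t ⟨ha.2.le, le_rfl⟩ ha.2.le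
    have h2 : Tendsto (fun a => u t - u a) (𝓝[>] t₀) (𝓝 (u t - 0)) := tendsto_const_nhds.sub hlim
    have h3 : Tendsto (fun a => c * (t - a)) (𝓝[>] t₀) (𝓝 (c * (t - t₀))) :=
      (((continuous_const.sub continuous_id).const_mul c).tendsto t₀).mono_left nhdsWithin_le_nhds
    rw [sub_zero] at h2
    exact le_of_tendsto_of_tendsto h3 h2 h1
  have hlow₁ := hlow u₁ h₁ hu₁ fun t ht => (hsub₁ (hIe ht)).1.1
  have hlow₂ := hlow u₂ h₂ hu₂ fun t ht => (hsub₁ (hIe ht)).1.2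
  have hDd : ∀ t ∈ Ioo t₀ b', HasDerivAt (fun t => u₁ t - u₂ t) (deriv u₁ t - deriv u₂ t) t :=
    fun t ht => (h₁ t (hIb ht)).2.1.hasDerivAt.sub (h₂ t (hIb ht)).2.1.hasDerivAt
  have himp : ∀ M : ℝ, 0 ≤ M → (∀ t ∈ Ioo t₀ b', |deriv u₁ t - deriv u₂ t| ≤ M) →
      ∀ t ∈ Ioo t₀ b', |deriv u₁ t - deriv u₂ t| ≤ M / 2 := by
    intro M hM0 hM t ht
    have key := abs_le_of_abs_deriv_le_deriv (t₀ := t₀) (b := b')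
      (f := fun t => deriv u₁ t - deriv u₂ t)
      (f' := fun t => (1 / u₁ t ^ α + p t) - (1 / u₂ t ^ α + p t))
      (φ := fun t => M * (A * (t - t₀) ^ (1 - α)))
      (φ' := fun t => M * (A * ((1 - α) * (t - t₀) ^ (1 - α - 1))))
      (fun t ht => (h₁ t (hIb ht)).2.2.sub (h₂ t (hIb ht)).2.2) (fun t ht => ?_) (fun t ht => ?_)
      hd (fun t ht => ?_) ht
    · have := (hsub₁ (hIe ht)).2.2
      refine key.trans ?_
      nlinarith
    · have h1 := ((hasDerivAt_id t).sub_const t₀).rpow_const (p := 1 - α)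
        (Or.inl (sub_pos.2 ht.1).ne')
      refine ((h1.const_mul A).const_mul M).congr_deriv ?_
      simp
    · have : 0 < t - t₀ := sub_pos.2 ht.1
      positivity
    · have hr : 0 < t - t₀ := sub_pos.2 ht.1
      have e1 := abs_le_of_abs_deriv_le hDd hD hM ht
      have e2 := abs_one_div_rpow_sub_le hα₀ (mul_pos hcpos hr) (hlow₁ t ht) (hlow₂ t ht)
      rw [add_sub_add_right_eq_sub]
      calc _ ≤ α * (c * (t - t₀)) ^ (-α - 1) * |u₁ t - u₂ t| := e2
        _ ≤ α * (c * (t - t₀)) ^ (-α - 1) * (M * (t - t₀)) := by gcongr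
        _ = _ := by
          rw [Real.mul_rpow hcpos.le hr.le, hA, show (1 - α - 1 : ℝ) = (-α - 1) + 1 by ring,
            Real.rpow_add_one hr.ne']
          field_simp
  have hiter : ∀ n : ℕ, ∀ t ∈ Ioo t₀ b', |deriv u₁ t - deriv u₂ t| ≤ (1 / 2) ^ n := by
    intro n
    induction n with
    | zero => exact fun t ht => by simpa using (hsub₁ (hIe ht)).2.1.le
    | succ n ih =>
      intro t ht
      have := himp _ (by positivity) ih t ht
      rw [pow_succ]
      linarith
  have hzero : ∀ t ∈ Ioo t₀ b', |deriv u₁ t - deriv u₂ t| ≤ 0 := fun t ht =>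
    ge_of_tendsto' (tendsto_pow_atTop_nhds_zero_of_lt_one (by norm_num) (by norm_num))
      fun n => hiter n t ht
  refine ⟨b', ⟨lt_min hb hb₁', min_le_left _ _⟩, fun t ht => ⟨?_, ?_⟩⟩
  · have := abs_le_of_abs_deriv_le hDd hD hzero ht
    rw [zero_mul] at this
    exact sub_eq_zero.1 (abs_nonpos_iff.1 this)
  · exact sub_eq_zero.1 (abs_nonpos_iff.1 (hzero t ht))

/-- Two solutions leaving the singularity with the same positive velocity agree: near the
singularity by `exists_eqOn_deriv_of_start`, and away from it because the equation is Lipschitz. -/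
theorem eq_of_start (hα₀ : 0 < α) (hα₁ : α < 1) (hb : t₀ < b) (hv₀ : 0 < v₀)
    (h₁ : IsClassicalSolutionOn α p u₁ (Ioo t₀ b)) (h₂ : IsClassicalSolutionOn α p u₂ (Ioo t₀ b))
    (hu₁ : Tendsto u₁ (𝓝[>] t₀) (𝓝 0)) (hu₂ : Tendsto u₂ (𝓝[>] t₀) (𝓝 0))
    (hd₁ : Tendsto (deriv u₁) (𝓝[>] t₀) (𝓝 v₀)) (hd₂ : Tendsto (deriv u₂) (𝓝[>] t₀) (𝓝 v₀)) :
    ∀ t ∈ Ioo t₀ b, u₁ t = u₂ t ∧ deriv u₁ t = deriv u₂ t := by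
  obtain ⟨b', hb', heq⟩ := exists_eqOn_deriv_of_start hα₀ hα₁ hb hv₀ h₁ h₂ hu₁ hu₂ hd₁ hd₂
  intro t ht
  rcases lt_or_ge t b' with htb | htb
  · exact heq t ⟨ht.1, htb⟩
  set a := (t₀ + b') / 2 with ha
  have ha1 : t₀ < a := by linarith [hb'.1]
  have ha2 : a < b' := by linarith [hb'.1]
  have hat : a ≤ t := ha2.le.trans htb
  have hsub : Icc a t ⊆ Ioo t₀ b := fun x hx => ⟨ha1.trans_le hx.1, hx.2.trans_lt ht.2⟩
  have hlow : ∀ u : ℝ → ℝ, IsClassicalSolutionOn α p u (Ioo t₀ b) →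
      ∃ κ > 0, ∀ x ∈ Icc a t, κ ≤ u x := by
    intro u hu
    obtain ⟨x, hx, hmin⟩ := isCompact_Icc.exists_isMinOn (nonempty_Icc.2 hat)
      (f := u) (fun x hx => (hu x (hsub hx)).2.1.continuousAt.continuousWithinAt)
    exact ⟨u x, (hu x (hsub hx)).1, fun y hy => hmin hy⟩
  obtain ⟨κ₁, hκ₁, hl₁⟩ := hlow u₁ h₁
  obtain ⟨κ₂, hκ₂, hl₂⟩ := hlow u₂ h₂
  set κ := min κ₁ κ₂ with hκ
  have hκpos : 0 < κ := lt_min hκ₁ hκ₂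
  set C : NNReal := ⟨α * κ ^ (-α - 1), by positivity⟩ with hC
  have hlip : ∀ r ∈ Ico a t, LipschitzOnWith (max 1 C)
      (fun x : ℝ × ℝ => (x.2, 1 / x.1 ^ α + p r)) {x | κ ≤ x.1} := by
    intro r _
    refine LipschitzOnWith.of_dist_le_mul fun x hx y hy => ?_
    have e1 := abs_one_div_rpow_sub_le hα₀ hκpos hx hy
    rw [Prod.dist_eq, max_le_iff]
    have hC1 : (1 : ℝ) ≤ (max 1 C : NNReal) := by exact_mod_cast le_max_left 1 C
    have hC2 : α * κ ^ (-α - 1) ≤ (max 1 C : NNReal) := by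
      have : C ≤ max 1 C := le_max_right 1 C
      exact this
    constructor
    · calc dist x.2 y.2 ≤ dist x y := by rw [Prod.dist_eq]; exact le_max_right _ _
        _ ≤ (max 1 C : NNReal) * dist x y := le_mul_of_one_le_left dist_nonneg hC1
    · simp only [Real.dist_eq, add_sub_add_right_eq_sub]
      refine e1.trans ?_
      gcongr
      rw [← Real.dist_eq, Prod.dist_eq]
      exact le_max_left _ _
  have hODE : ∀ u : ℝ → ℝ, IsClassicalSolutionOn α p u (Ioo t₀ b) → ∀ x ∈ Icc a t,
      HasDerivAt (fun r => (u r, deriv u r)) (deriv u x, 1 / u x ^ α + p x) x := fun u hu x hx =>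
    (hu x (hsub hx)).2.1.hasDerivAt.prodMk (hu x (hsub hx)).2.2
  have huniq := ODE_solution_unique_of_mem_Icc_right
    (v := fun r (x : ℝ × ℝ) => (x.2, 1 / x.1 ^ α + p r)) (s := fun _ => {x | κ ≤ x.1})
    (f := fun r => (u₁ r, deriv u₁ r)) (g := fun r => (u₂ r, deriv u₂ r)) hlip
    (fun x hx => (hODE u₁ h₁ x hx).continuousAt.continuousWithinAt)
    (fun x hx => (hODE u₁ h₁ x (Ico_subset_Icc_self hx)).hasDerivWithinAt)
    (fun x hx => (min_le_left _ _).trans (hl₁ x (Ico_subset_Icc_self hx)))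
    (fun x hx => (hODE u₂ h₂ x hx).continuousAt.continuousWithinAt)
    (fun x hx => (hODE u₂ h₂ x (Ico_subset_Icc_self hx)).hasDerivWithinAt)
    (fun x hx => (min_le_right _ _).trans (hl₂ x (Ico_subset_Icc_self hx)))
    (by simp only [(heq a ⟨ha1, ha2⟩).1, (heq a ⟨ha1, ha2⟩).2])
  have := huniq ⟨hat, le_rfl⟩
  simpa using this

theorem IsSuccessor.unique (hα₀ : 0 < α) (hα₁ : α < 1) {x y y' : ℝ × ℝ} (hx : 0 < x.2)
    (h : IsSuccessor α p x y) (h' : IsSuccessor α p x y') : y = y' := by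
  -- a solution cannot vanish before the end of its interval of positivity
  have hle : ∀ y y' : ℝ × ℝ, IsSuccessor α p x y → IsSuccessor α p x y' → y'.1 ≤ y.1 := by
    rintro y y' ⟨hxy, u, hu, hu0, hd0, hu1, hd1⟩ ⟨hxy', u', hu', hu0', hd0', hu1', hd1'⟩
    by_contra! hlt
    have hmem : y.1 ∈ Ioo x.1 y'.1 := ⟨hxy, hlt⟩
    have heq := eq_of_start hα₀ hα₁ hxy hx hu
      (fun t ht => hu' t ⟨ht.1, ht.2.trans hlt⟩) hu0 hu0' hd0 hd0'
    have h1 : Tendsto u (𝓝[<] y.1) (𝓝 (u' y.1)) := by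
      refine Tendsto.congr' ?_ ((hu' _ hmem).2.1.continuousAt.tendsto.mono_left
        nhdsWithin_le_nhds)
      filter_upwards [Ioo_mem_nhdsLT hxy] with t ht using (heq t ht).1.symm
    exact (hu' _ hmem).1.ne' (tendsto_nhds_unique h1 hu1)
  have h1 : y.1 = y'.1 := le_antisymm (hle y' y h' h) (hle y y' h h')
  obtain ⟨hxy, u, hu, hu0, hd0, hu1, hd1⟩ := h
  obtain ⟨hxy', u', hu', hu0', hd0', hu1', hd1'⟩ := h'
  rw [← h1] at hu' hd1'
  have heq := eq_of_start hα₀ hα₁ hxy hx hu hu' hu0 hu0' hd0 hd0'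
  have h2 : Tendsto (deriv u) (𝓝[<] y.1) (𝓝 (-y'.2)) := by
    refine Tendsto.congr' ?_ hd1'
    filter_upwards [Ioo_mem_nhdsLT hxy] with t ht using (heq t ht).2.symm
  exact Prod.ext h1 (neg_injective (tendsto_nhds_unique hd1 h2))

/-- Time reversal exchanges a point and its successor. -/
theorem IsSuccessor.reverse {x y : ℝ × ℝ} (h : IsSuccessor α p x y) :
    IsSuccessor α (fun t => p (-t)) (-y.1, y.2) (-x.1, x.2) := by
  obtain ⟨hxy, u, hu, hu0, hd0, hu1, hd1⟩ := h
  have hneg : ∀ t ∈ Ioo (-y.1) (-x.1), -t ∈ Ioo x.1 y.1 := fun t ht =>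
    ⟨by linarith [ht.2], by linarith [ht.1]⟩
  have hder : deriv (fun t => u (-t)) = fun t => -deriv u (-t) := by
    ext t
    exact deriv_comp_neg u t
  have hl : ∀ a : ℝ, Tendsto (fun t : ℝ => -t) (𝓝[>] (-a)) (𝓝[<] a) := fun a => by
    simpa using tendsto_neg_nhdsGT (a := -a)
  have hr : ∀ a : ℝ, Tendsto (fun t : ℝ => -t) (𝓝[<] (-a)) (𝓝[>] a) := fun a => by
    simpa using tendsto_neg_nhdsLT (a := -a)
  refine ⟨neg_lt_neg hxy, fun t => u (-t), fun t ht => ?_, hu1.comp (hl _), ?_, hu0.comp (hr _), ?_⟩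
  · obtain ⟨h1, h2, h3⟩ := hu _ (hneg t ht)
    refine ⟨h1, DifferentiableAt.comp t h2 differentiableAt_id.neg, ?_⟩
    rw [hder]
    simpa using! (h3.comp t (hasDerivAt_neg t)).neg
  · rw [hder]
    simpa using (hd1.comp (hl _)).neg
  · rw [hder]
    exact (hd0.comp (hr _)).neg

theorem IsSuccessor.injective (hα₀ : 0 < α) (hα₁ : α < 1) {x x' y : ℝ × ℝ} (hy : 0 < y.2)
    (h : IsSuccessor α p x y) (h' : IsSuccessor α p x' y) : x = x' := by
  have := IsSuccessor.unique hα₀ hα₁ (x := (-y.1, y.2)) hy h.reverse h'.reverse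
  simp only [Prod.mk.injEq, neg_inj] at this
  exact Prod.ext this.1 this.2

end

/-! ### Transversality of the return and Liouville's theorem -/

/-- Stability of the first return to `s = 0`: a curve that starts at `s = 0` and stays close to a
given returning one returns as well, at a time that depends Lipschitz continuously on the
perturbation because the return is transversal. -/
theorem exists_nearby_return {m R T : ℝ} {s v : ℝ → ℝ} (hm : 0 < m) (hT : 0 < T) (hR : 0 < R)
    (hs : ∀ τ, HasDerivAt s (m * v τ) τ) (hv : Continuous v) (hs0 : s 0 = 0) (hv0 : 0 < v 0)
    (hsT : s T = 0) (hvT : v T < 0) (hpos : ∀ τ ∈ Ioo 0 T, 0 < s τ ∧ s τ < R) :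
    ∃ δ > 0, ∃ C ≥ 0, ∀ e ≤ δ, ∀ s₁ v₁ : ℝ → ℝ, (∀ τ, HasDerivAt s₁ (m * v₁ τ) τ) → s₁ 0 = 0 →
      (∀ τ ∈ Icc 0 (T + 1), |s₁ τ - s τ| ≤ e ∧ |v₁ τ - v τ| ≤ e) →
      ∃ T₁ ∈ Ioo 0 (T + 1), |T₁ - T| ≤ C * e ∧ s₁ T₁ = 0 ∧
        ∀ τ ∈ Ioo 0 T₁, 0 < s₁ τ ∧ s₁ τ < R := by
  have hsc : Continuous s := continuous_of_forall_hasDerivAt hs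
  obtain ⟨r₁, hr₁, hball₁⟩ := Metric.eventually_nhds_iff.1
    (hv.continuousAt.eventually (lt_mem_nhds (half_lt_self hv0)))
  obtain ⟨r₂, hr₂, hball₂⟩ := Metric.eventually_nhds_iff.1
    (hv.continuousAt.eventually (gt_mem_nhds (show v T < v T / 2 by linarith)))
  obtain ⟨r, hr, hrr₁, hrr₂, hrT, hr1⟩ : ∃ r > 0, r < r₁ ∧ r < r₂ ∧ r < T / 2 ∧ r < 1 := by
    have h := lt_min (lt_min hr₁ hr₂) (lt_min (half_pos hT) one_pos)
    have h2 := half_lt_self h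
    refine ⟨_, half_pos h, ?_, ?_, ?_, ?_⟩
    · exact h2.trans_le ((min_le_left _ _).trans (min_le_left _ _))
    · exact h2.trans_le ((min_le_left _ _).trans (min_le_right _ _))
    · exact h2.trans_le ((min_le_right _ _).trans (min_le_left _ _))
    · exact h2.trans_le ((min_le_right _ _).trans (min_le_right _ _))
  have hvl : ∀ τ ∈ Icc 0 r, v 0 / 2 < v τ := fun τ hτ => hball₁ (by
    rw [Real.dist_eq, sub_zero, abs_of_nonneg hτ.1]
    exact hτ.2.trans_lt hrr₁)
  have hvr : ∀ τ ∈ Icc (T - r) (T + r), v τ < v T / 2 := fun τ hτ => hball₂ (by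
    rw [Real.dist_eq, abs_lt]
    constructor <;> linarith [hτ.1, hτ.2])
  have hsanti : StrictAntiOn s (Icc (T - r) (T + r)) :=
    strictAntiOn_of_deriv_neg (convex_Icc _ _) hsc.continuousOn fun x hx => by
      rw [(hs x).deriv]
      exact mul_neg_of_pos_of_neg hm (by linarith [hvr x (interior_subset hx)])
  have hTI : T ∈ Icc (T - r) (T + r) := ⟨by linarith, by linarith⟩
  have hend : s (T + r) < 0 := by
    rw [← hsT]
    exact hsanti hTI ⟨by linarith, le_rfl⟩ (by linarith)
  obtain ⟨x₁, hx₁, hmin⟩ := isCompact_Icc.exists_isMinOn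
    (nonempty_Icc.2 (by linarith : r ≤ T - r)) hsc.continuousOn
  have hκ : 0 < s x₁ := (hpos x₁ ⟨by linarith [hx₁.1], by linarith [hx₁.2]⟩).1
  obtain ⟨x₂, hx₂, hmax⟩ := isCompact_Icc.exists_isMaxOn
    (nonempty_Icc.2 (by linarith : 0 ≤ T + r)) hsc.continuousOn
  have hx₂R : s x₂ < R := by
    rcases hx₂.1.eq_or_lt with h | h
    · rw [← h, hs0]
      exact hR
    rcases lt_or_ge x₂ T with h' | h'
    · exact (hpos x₂ ⟨h, h'⟩).2
    · have := hsanti.antitoneOn hTI ⟨by linarith, hx₂.2⟩ h'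
      rw [hsT] at this
      linarith
  obtain ⟨δ, hδ, hδ₁, hδ₂, hδ₃, hδ₄, hδ₅⟩ : ∃ δ > 0, δ < v 0 / 4 ∧ δ < -v T / 4 ∧ δ < s x₁ ∧
      δ < -s (T + r) ∧ δ < R - s x₂ := by
    have h := lt_min (lt_min (show 0 < v 0 / 4 by positivity) (show 0 < -v T / 4 by linarith))
      (lt_min hκ (lt_min (neg_pos.2 hend) (sub_pos.2 hx₂R)))
    have h2 := half_lt_self h
    refine ⟨_, half_pos h, ?_, ?_, ?_, ?_, ?_⟩
    · exact h2.trans_le ((min_le_left _ _).trans (min_le_left _ _))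
    · exact h2.trans_le ((min_le_left _ _).trans (min_le_right _ _))
    · exact h2.trans_le ((min_le_right _ _).trans (min_le_left _ _))
    · exact h2.trans_le ((min_le_right _ _).trans ((min_le_right _ _).trans (min_le_left _ _)))
    · exact h2.trans_le ((min_le_right _ _).trans ((min_le_right _ _).trans (min_le_right _ _)))
  have hC : 0 < m * (-v T / 4) := mul_pos hm (by linarith)
  refine ⟨δ, hδ, 1 / (m * (-v T / 4)), by positivity, fun e he s₁ v₁ hs₁ hs₁0 hclose => ?_⟩
  have hs₁c : Continuous s₁ := continuous_of_forall_hasDerivAt hs₁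
  have hcl : ∀ τ, 0 ≤ τ → τ ≤ T + r → |s₁ τ - s τ| ≤ e ∧ |v₁ τ - v τ| ≤ e := fun τ h1 h2 =>
    hclose τ ⟨h1, by linarith⟩
  have hv₁r : ∀ τ ∈ Icc (T - r) (T + r), v₁ τ < v T / 4 := fun τ hτ => by
    have h1 := (abs_le.1 (hcl τ (by linarith [hτ.1]) hτ.2).2).2
    have h2 := hvr τ hτ
    linarith
  have hmid : ∀ τ ∈ Icc r (T - r), 0 < s₁ τ := fun τ hτ => by
    have h1 := (abs_le.1 (hcl τ (by linarith [hτ.1]) (by linarith [hτ.2])).1).1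
    have h2 : s x₁ ≤ s τ := hmin hτ
    linarith
  obtain ⟨T₁, hT₁, hsT₁, hpos₁⟩ := exists_first_zero hs₁c (by linarith : T - r ≤ T + r)
    (hmid _ ⟨by linarith, le_rfl⟩)
    (by linarith [(abs_le.1 (hcl (T + r) (by linarith) le_rfl).1).2])
  have hT₁0 : 0 < T₁ := by linarith [hT₁.1]
  refine ⟨T₁, ⟨hT₁0, by linarith [hT₁.2]⟩, ?_, hsT₁, fun τ hτ => ⟨?_, ?_⟩⟩
  · have hgap : ∀ a b, T - r ≤ a → b ≤ T + r → a ≤ b → m * (-v T / 4) * (b - a) ≤ s₁ a - s₁ b := by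
      intro a b ha hb hab
      have := mul_sub_le_of_le_hasDerivAt (fun x => (hs₁ x).neg) (c := m * (-v T / 4)) hab
        fun x hx => by
          have := hv₁r x ⟨ha.trans hx.1, hx.2.trans hb⟩
          nlinarith
      simp only [Pi.neg_apply] at this
      linarith
    have hsT₁' := (hcl T hT.le (by linarith)).1
    rw [hsT, sub_zero, abs_le] at hsT₁'
    rw [one_div, ← div_eq_inv_mul, le_div_iff₀ hC]
    rcases le_total T₁ T with h | h
    · rw [abs_of_nonpos (by linarith)]
      have := hgap T₁ T hT₁.1.le (by linarith) h
      linarith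
    · rw [abs_of_nonneg (by linarith)]
      have := hgap T T₁ (by linarith) hT₁.2 h
      linarith
  · rcases le_or_gt τ r with h | h
    · have hmono : StrictMonoOn s₁ (Icc 0 r) :=
        strictMonoOn_of_deriv_pos (convex_Icc _ _) hs₁c.continuousOn fun x hx => by
          rw [(hs₁ x).deriv]
          have hx' := interior_subset hx
          have h1 := (abs_le.1 (hcl x hx'.1 (by linarith [hx'.2])).2).1
          exact mul_pos hm (by linarith [hvl x hx'])
      rw [← hs₁0]
      exact hmono ⟨le_rfl, hr.le⟩ ⟨hτ.1.le, h⟩ hτ.1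
    rcases le_or_gt τ (T - r) with h' | h'
    · exact hmid τ ⟨h.le, h'⟩
    · exact hpos₁ τ ⟨h'.le, hτ.2⟩
  · have hτ2 : τ ≤ T + r := hτ.2.le.trans hT₁.2
    have h1 := (abs_le.1 (hcl τ hτ.1.le hτ2).1).2
    have h2 : s τ ≤ s x₂ := hmax ⟨hτ.1.le, hτ2⟩
    linarith

/-- The determinant of an endomorphism of the plane. -/
theorem ContinuousLinearMap.det_prod_real (L : ℝ × ℝ →L[ℝ] ℝ × ℝ) :
    L.det = (L (1, 0)).1 * (L (0, 1)).2 - (L (0, 1)).1 * (L (1, 0)).2 := by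
  rw [ContinuousLinearMap.det, ← LinearMap.det_toMatrix (Module.Basis.finTwoProd ℝ),
    Matrix.det_fin_two]
  simp [LinearMap.toMatrix_apply]

section

variable {m : ℝ} {g dg P p : ℝ → ℝ} {X : ℝ → ℝ × ℝ × ℝ}

theorem HasDerivAt.fst_prod {E F : Type*} [NormedAddCommGroup E] [NormedSpace ℝ E]
    [NormedAddCommGroup F] [NormedSpace ℝ F] {f : ℝ → E × F} {f' : E × F} {x : ℝ}
    (h : HasDerivAt f f' x) : HasDerivAt (fun x => (f x).1) f'.1 x := by
  simpa using (HasFDerivAt.fst h.hasFDerivAt).hasDerivAt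

theorem HasDerivAt.snd_prod {E F : Type*} [NormedAddCommGroup E] [NormedSpace ℝ E]
    [NormedAddCommGroup F] [NormedSpace ℝ F] {f : ℝ → E × F} {f' : E × F} {x : ℝ}
    (h : HasDerivAt f f' x) : HasDerivAt (fun x => (f x).2) f'.2 x := by
  simpa using (HasFDerivAt.snd h.hasFDerivAt).hasDerivAt

theorem isRegOrbit_of_hasDerivAt (h : ∀ τ, HasDerivAt X (regField m g P (X τ)) τ) :
    IsRegOrbit m g P (fun τ => (X τ).1) (fun τ => (X τ).2.1) (fun τ => (X τ).2.2) where
  hasDerivAt_t τ := (h τ).fst_prod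
  hasDerivAt_s τ := (h τ).snd_prod.fst_prod
  hasDerivAt_z τ := (h τ).snd_prod.snd_prod

/-- Liouville's theorem for the divergence-free regularised field: the determinant formed by its
velocity and two solutions of the variational equation is constant along an orbit. -/
theorem regField_wronskian_eq (hg : ∀ s, HasDerivAt g (dg s) s)
    (hP : ∀ t, HasDerivAt P (p t) t) (h : ∀ τ, HasDerivAt X (regField m g P (X τ)) τ)
    {Y : ℝ → ℝ × ℝ →L[ℝ] ℝ × ℝ × ℝ}
    (hY : ∀ τ, HasDerivAt Y ((regFieldDeriv m dg p (X τ)).comp (Y τ)) τ) (τ τ' : ℝ) :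
    let W : ℝ → ℝ := fun τ =>
      (Y τ (1, 0)).1 * ((m * ((X τ).2.2 + P (X τ).1)) * (Y τ (0, 1)).2.2
          - (Y τ (0, 1)).2.1 * (X τ).2.1)
        - g (X τ).2.1 * ((Y τ (1, 0)).2.1 * (Y τ (0, 1)).2.2 - (Y τ (0, 1)).2.1 * (Y τ (1, 0)).2.2)
        + (Y τ (0, 1)).1 * ((Y τ (1, 0)).2.1 * (X τ).2.1
          - (m * ((X τ).2.2 + P (X τ).1)) * (Y τ (1, 0)).2.2)
    W τ = W τ' := by
  intro W
  have hX := isRegOrbit_of_hasDerivAt h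
  have hy : ∀ e τ, HasDerivAt (fun τ => Y τ e)
      (dg (X τ).2.1 * (Y τ e).2.1, m * ((Y τ e).2.2 + p (X τ).1 * (Y τ e).1), (Y τ e).2.1) τ := by
    intro e τ
    have := (hY τ).clm_apply (hasDerivAt_const τ e)
    simp only [map_zero, add_zero, ContinuousLinearMap.comp_apply, regFieldDeriv_apply] at this
    exact this
  have hW : ∀ τ, HasDerivAt W 0 τ := by
    intro τ
    have a₁ := (hy (1, 0) τ).fst_prod
    have b₁ := (hy (1, 0) τ).snd_prod.fst_prod
    have c₁ := (hy (1, 0) τ).snd_prod.snd_prod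
    have a₂ := (hy (0, 1) τ).fst_prod
    have b₂ := (hy (0, 1) τ).snd_prod.fst_prod
    have c₂ := (hy (0, 1) τ).snd_prod.snd_prod
    have hs := hX.hasDerivAt_s τ
    have hξ := (hg (X τ).2.1).comp τ hs
    have hσ := (hX.hasDerivAt_velocity hP τ).const_mul m
    have key := ((a₁.mul ((hσ.mul c₂).sub (b₂.mul hs))).sub
      (hξ.mul ((b₁.mul c₂).sub (b₂.mul c₁)))).add (a₂.mul ((b₁.mul hs).sub (hσ.mul c₁)))
    refine key.congr_deriv ?_
    simp only [Pi.mul_apply, Pi.sub_apply, Function.comp_apply]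
    ring
  exact is_const_of_deriv_eq_zero (fun τ => (hW τ).differentiableAt) (fun τ => (hW τ).deriv) τ τ'

end

/-! ### Differentiability of the first return map -/

theorem exists_cutoff_level {m q p₁ : ℝ} (hq : 1 < q) (hp₁ : p₁ < 0) (a B : ℝ) :
    ∃ R, B < R ∧ 0 < R ∧ a + R ^ 2 / (2 * m) + p₁ * R ^ (q + 1) < 0 := by
  have h1 : ∀ᶠ R : ℝ in atTop, (1 / (2 * m) + |a|) / -p₁ < R ^ (q - 1) :=
    (tendsto_rpow_atTop (by linarith)).eventually_gt_atTop _
  obtain ⟨R, hR, hRB, hR1⟩ := (h1.and ((eventually_gt_atTop B).and (eventually_ge_atTop 1))).exists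
  have hR0 : 0 < R := by linarith
  refine ⟨R, hRB, hR0, ?_⟩
  rw [div_lt_iff₀ (by linarith)] at hR
  have e1 : R ^ (q + 1) = R ^ 2 * R ^ (q - 1) := by
    rw [← Real.rpow_natCast R 2, ← Real.rpow_add hR0]
    congr 1
    push_cast
    ring
  have h2 : R ^ 2 * (1 / (2 * m) + |a|) < R ^ 2 * (R ^ (q - 1) * -p₁) := by gcongr
  have h3 : |a| ≤ R ^ 2 * |a| := le_mul_of_one_le_left (abs_nonneg a) (by nlinarith)
  have h4 := le_abs_self a
  rw [e1, div_eq_mul_one_div]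
  linarith

/-- The initial condition of the regularised system for a solution that leaves the singularity at
time `x.1` with velocity `x.2`. -/
noncomputable def regInit (P : ℝ → ℝ) (x : ℝ × ℝ) : ℝ × ℝ × ℝ := (x.1, 0, x.2 - P x.1)

/-- The time and the arrival velocity of a point of the section `s = 0`. -/
noncomputable def regExit (P : ℝ → ℝ) (X : ℝ × ℝ × ℝ) : ℝ × ℝ := (X.1, -(X.2.2 + P X.1))

section

variable {m : ℝ} {g dg P p : ℝ → ℝ}

theorem hasFDerivAt_regInit (hP : ∀ t, HasDerivAt P (p t) t) (x : ℝ × ℝ) :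
    HasFDerivAt (regInit P) ((ContinuousLinearMap.fst ℝ ℝ ℝ).prod ((0 : ℝ × ℝ →L[ℝ] ℝ).prod
      (ContinuousLinearMap.snd ℝ ℝ ℝ - p x.1 • ContinuousLinearMap.fst ℝ ℝ ℝ))) x :=
  hasFDerivAt_fst.prodMk ((hasFDerivAt_const (0 : ℝ) x).prodMk
    (hasFDerivAt_snd.sub ((hP x.1).comp_hasFDerivAt x hasFDerivAt_fst)))

theorem hasFDerivAt_regExit (hP : ∀ t, HasDerivAt P (p t) t) (X : ℝ × ℝ × ℝ) :
    HasFDerivAt (regExit P) ((ContinuousLinearMap.fst ℝ ℝ (ℝ × ℝ)).prod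
      (-((ContinuousLinearMap.snd ℝ ℝ ℝ).comp (ContinuousLinearMap.snd ℝ ℝ (ℝ × ℝ)) +
        p X.1 • ContinuousLinearMap.fst ℝ ℝ (ℝ × ℝ)))) X := by
  have hZ : HasFDerivAt (fun X : ℝ × ℝ × ℝ => X.2.2)
      ((ContinuousLinearMap.snd ℝ ℝ ℝ).comp (ContinuousLinearMap.snd ℝ ℝ (ℝ × ℝ))) X :=
    HasFDerivAt.snd hasFDerivAt_snd
  exact hasFDerivAt_fst.prodMk (hZ.add ((hP X.1).comp_hasFDerivAt X hasFDerivAt_fst)).neg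

theorem abs_primitive_sub_le {B : ℝ} (hP : ∀ t, HasDerivAt P (p t) t) (hB : ∀ t, |p t| ≤ B)
    (a b : ℝ) : |P a - P b| ≤ B * |a - b| := by
  lift B to NNReal using (abs_nonneg _).trans (hB 0)
  simpa [Real.dist_eq] using (lipschitzWith_of_hasDerivAt hP hB).dist_le_mul a b

theorem norm_regInit_sub_le {B : ℝ} (hP : ∀ t, HasDerivAt P (p t) t) (hB : ∀ t, |p t| ≤ B)
    (x y : ℝ × ℝ) : ‖regInit P x - regInit P y‖ ≤ (1 + B) * ‖x - y‖ := by
  have hB0 : 0 ≤ B := (abs_nonneg _).trans (hB 0)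
  have h1 : |x.1 - y.1| ≤ ‖x - y‖ := norm_fst_le (x - y)
  have h2 : |x.2 - y.2| ≤ ‖x - y‖ := norm_snd_le (x - y)
  have h3 := abs_primitive_sub_le hP hB x.1 y.1
  have h4 : B * |x.1 - y.1| ≤ B * ‖x - y‖ := by gcongr
  have h5 : 0 ≤ B * ‖x - y‖ := by positivity
  simp only [regInit, Prod.norm_def, Prod.fst_sub, Prod.snd_sub, Real.norm_eq_abs, sub_self,
    abs_zero] at *
  refine max_le (by linarith) (max_le (by linarith [abs_nonneg (x.1 - y.1)]) ?_)
  have : x.2 - P x.1 - (y.2 - P y.1) = (x.2 - y.2) - (P x.1 - P y.1) := by ring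
  rw [this]
  exact (abs_sub _ _).trans (by linarith)

theorem norm_regExit_sub_le {B c : ℝ} (hP : ∀ t, HasDerivAt P (p t) t) (hB : ∀ t, |p t| ≤ B)
    {X X' : ℝ × ℝ × ℝ} (h1 : |X.1 - X'.1| ≤ c) (h2 : |X.2.2 - X'.2.2| ≤ c) :
    ‖regExit P X - regExit P X'‖ ≤ (1 + B) * c := by
  have hB0 : 0 ≤ B := (abs_nonneg _).trans (hB 0)
  have h3 := abs_primitive_sub_le hP hB X.1 X'.1
  have h4 : B * |X.1 - X'.1| ≤ B * c := by gcongr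
  have h5 : 0 ≤ B * c := mul_nonneg hB0 ((abs_nonneg _).trans h1)
  simp only [regExit, Prod.norm_def, Prod.fst_sub, Prod.snd_sub, Real.norm_eq_abs]
  refine max_le (by linarith) ?_
  have : -(X.2.2 + P X.1) - -(X'.2.2 + P X'.1) = -((X.2.2 - X'.2.2) + (P X.1 - P X'.1)) := by ring
  rw [this, abs_neg]
  exact (abs_add_le _ _).trans (by linarith)

end

/-- Near a point whose orbit returns, the first return map of the regularised flow is
differentiable. The derivative is that of the flow at the return time `T` of the base point: the
variation of the return time does not contribute, as the velocity of `t` and `z` vanishes at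
`s = 0`. -/
theorem hasFDerivAt_firstReturn {m q R B T : ℝ} {P p : ℝ → ℝ} (hm : 0 < m) (hq : 1 < q)
    (hR : 0 < R) (hp : Continuous p) (hP : ∀ t, HasDerivAt P (p t) t) (hB : ∀ t, |p t| ≤ B)
    {Φ : ℝ × ℝ → ℝ → ℝ × ℝ × ℝ} (hΦ0 : ∀ x, Φ x 0 = regInit P x)
    (hΦ : ∀ x τ, HasDerivAt (Φ x) (regField m (cutoffPow q R) P (Φ x τ)) τ)
    {x₀ : ℝ × ℝ} (hx₀ : 0 < x₀.2) (hT : 0 < T) (hsT : (Φ x₀ T).2.1 = 0)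
    (hvT : (Φ x₀ T).2.2 + P (Φ x₀ T).1 < 0)
    (hpos : ∀ τ ∈ Ioo 0 T, 0 < (Φ x₀ τ).2.1 ∧ (Φ x₀ τ).2.1 < R)
    {S : ℝ × ℝ → ℝ × ℝ} (hS : ∀ x T₁, 0 < x.2 → 0 < T₁ → (Φ x T₁).2.1 = 0 →
      (∀ τ ∈ Ioo 0 T₁, 0 < (Φ x τ).2.1 ∧ (Φ x τ).2.1 < R) → S x = regExit P (Φ x T₁)) :
    ∃ L : ℝ × ℝ →L[ℝ] ℝ × ℝ, HasFDerivAt S L x₀ ∧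
      L.det * -((Φ x₀ T).2.2 + P (Φ x₀ T).1) = x₀.2 := by
  set g := cutoffPow q R with hgdef
  have hg : ∀ s, HasDerivAt g (cutoffPowDeriv q R s) s := hasDerivAt_cutoffPow hq R
  have hB0 : 0 ≤ B := (abs_nonneg _).trans (hB 0)
  set A := q * R ^ (q - 1) with hA
  have hA0 : 0 < A := by positivity
  have hdg : ∀ s, |cutoffPowDeriv q R s| ≤ A := abs_cutoffPowDeriv_le hq hR.le
  have hgle : ∀ s, |g s| ≤ A * |s| := by
    intro s
    have := abs_primitive_sub_le hg hdg s 0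
    rwa [hgdef, cutoffPow_zero, sub_zero, sub_zero] at this
  obtain ⟨K, hK⟩ := exists_lipschitzWith_regField (m := m) hg hP hdg hB
  have hF := hasFDerivAt_regField (m := m) hg hP
  have hF' : Continuous (regFieldDeriv m (cutoffPowDeriv q R) p) :=
    continuous_regFieldDeriv (continuous_cutoffPowDeriv hq R) hp
  have horb : ∀ x, IsRegOrbit m g P (fun τ => (Φ x τ).1) (fun τ => (Φ x τ).2.1)
      (fun τ => (Φ x τ).2.2) := fun x => isRegOrbit_of_hasDerivAt (hΦ x)
  have hΦc : Continuous (Φ x₀) := continuous_iff_continuousAt.2 fun τ => (hΦ x₀ τ).continuousAt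
  have hvel : ∀ x, (Φ x 0).2.2 + P (Φ x 0).1 = x.2 := fun x => by simp [hΦ0, regInit]
  -- the variational equation
  have hF'le : ∀ x, ‖regFieldDeriv m (cutoffPowDeriv q R) p x‖ ≤ K := fun x =>
    (hF x).le_of_lipschitz hK
  obtain ⟨Y, hY0, hY⟩ := exists_global_solution
    (f := fun τ (Y : ℝ × ℝ →L[ℝ] ℝ × ℝ × ℝ) =>
      (regFieldDeriv m (cutoffPowDeriv q R) p (Φ x₀ τ)).comp Y) (K := K) (C := 0)
    (fun Y => (hF'.comp hΦc).clm_comp continuous_const)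
    (fun τ => LipschitzWith.of_dist_le_mul fun Y Y' => by
      rw [dist_eq_norm, dist_eq_norm, ← ContinuousLinearMap.comp_sub]
      exact (ContinuousLinearMap.opNorm_comp_le _ _).trans (by gcongr; exact hF'le _))
    (fun τ => by simp)
    ((ContinuousLinearMap.fst ℝ ℝ ℝ).prod ((0 : ℝ × ℝ →L[ℝ] ℝ).prod
      (ContinuousLinearMap.snd ℝ ℝ ℝ - p x₀.1 • ContinuousLinearMap.fst ℝ ℝ ℝ)))
  have hflow : HasFDerivAt (fun x => Φ x T) (Y T) x₀ := by
    refine hasFDerivAt_flow hF hF' hK hΦ hY ?_ hT.le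
    simp only [hΦ0, hY0]
    exact hasFDerivAt_regInit hP x₀
  have hexit := (hasFDerivAt_regExit hP (Φ x₀ T)).comp x₀ hflow
  -- uniform closeness of the orbits of nearby points
  set C₁ := (1 + B) * ((1 + B) * Real.exp (K * (T + 1))) with hC₁
  have hC₁0 : 0 < C₁ := by positivity
  have hclose : ∀ x, ∀ τ ∈ Icc 0 (T + 1), ‖Φ x τ - Φ x₀ τ‖ ≤
      (1 + B) * ‖x - x₀‖ * Real.exp (K * (T + 1)) := by
    intro x τ hτ
    have h1 := dist_le_of_trajectories_ODE (v := fun _ => regField m g P) (K := K)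
      (f := Φ x) (g := Φ x₀) (a := 0) (b := T + 1) (δ := (1 + B) * ‖x - x₀‖) (fun _ => hK)
      (fun t _ => (hΦ x t).continuousAt.continuousWithinAt)
      (fun t _ => (hΦ x t).hasDerivWithinAt)
      (fun t _ => (hΦ x₀ t).continuousAt.continuousWithinAt)
      (fun t _ => (hΦ x₀ t).hasDerivWithinAt)
      (by rw [dist_eq_norm, hΦ0, hΦ0]; exact norm_regInit_sub_le hP hB x x₀) τ hτ
    rw [dist_eq_norm] at h1
    refine h1.trans ?_
    gcongr
    linarith [hτ.2]
  have hcs : ∀ x, ∀ τ ∈ Icc 0 (T + 1), |(Φ x τ).2.1 - (Φ x₀ τ).2.1| ≤ C₁ * ‖x - x₀‖ ∧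
      |((Φ x τ).2.2 + P (Φ x τ).1) - ((Φ x₀ τ).2.2 + P (Φ x₀ τ).1)| ≤ C₁ * ‖x - x₀‖ := by
    intro x τ hτ
    have h1 := hclose x τ hτ
    set e := (1 + B) * ‖x - x₀‖ * Real.exp (K * (T + 1)) with he
    have heq : C₁ * ‖x - x₀‖ = (1 + B) * e := by rw [hC₁, he]; ring
    have he0 : 0 ≤ B * e := by positivity
    have h2 : |(Φ x τ).1 - (Φ x₀ τ).1| ≤ e := (norm_fst_le (Φ x τ - Φ x₀ τ)).trans h1
    have h3 := (norm_snd_le (Φ x τ - Φ x₀ τ)).trans h1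
    have h4 : |(Φ x τ).2.1 - (Φ x₀ τ).2.1| ≤ e := (norm_fst_le (Φ x τ - Φ x₀ τ).2).trans h3
    have h5 : |(Φ x τ).2.2 - (Φ x₀ τ).2.2| ≤ e := (norm_snd_le (Φ x τ - Φ x₀ τ).2).trans h3
    have h6 := abs_primitive_sub_le hP hB (Φ x τ).1 (Φ x₀ τ).1
    have h7 : B * |(Φ x τ).1 - (Φ x₀ τ).1| ≤ B * e := by gcongr
    rw [heq]
    refine ⟨by linarith, ?_⟩
    rw [add_sub_add_comm]
    exact (abs_add_le _ _).trans (by linarith)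
  have hvc := continuous_of_forall_hasDerivAt ((horb x₀).hasDerivAt_velocity hP)
  have hsc := continuous_of_forall_hasDerivAt (horb x₀).hasDerivAt_s
  obtain ⟨δ, hδ, C, hC, hret⟩ := exists_nearby_return hm hT hR (horb x₀).hasDerivAt_s hvc
    (by simp [hΦ0, regInit]) (by rw [hvel]; exact hx₀) hsT hvT hpos
  have hdist : Tendsto (fun x : ℝ × ℝ => ‖x - x₀‖) (𝓝 x₀) (𝓝 0) := by
    have : Continuous fun x : ℝ × ℝ => ‖x - x₀‖ := by fun_prop
    simpa using this.tendsto x₀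
  have hdistC : ∀ c r : ℝ, 0 < r → ∀ᶠ x in 𝓝 x₀, c * ‖x - x₀‖ < r := fun c r hr => by
    have := hdist.const_mul c
    rw [mul_zero] at this
    exact this.eventually (gt_mem_nhds hr)
  have hx2 : ∀ᶠ x : ℝ × ℝ in 𝓝 x₀, 0 < x.2 :=
    continuous_snd.continuousAt.eventually (lt_mem_nhds hx₀)
  -- the return map and the flow at the time `T` agree to first order
  have hlittle : ∀ ε > 0, ∀ᶠ x in 𝓝 x₀, ‖S x - regExit P (Φ x T)‖ ≤ ε * ‖x - x₀‖ := by
    intro ε hε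
    set M := (1 + B) * ((A + 1) * (C * C₁)) with hM
    have hM0 : 0 ≤ M := by positivity
    set ε' := ε / (M + 1) with hε'
    have hε'0 : 0 < ε' := by positivity
    obtain ⟨r, hr, hball⟩ := Metric.eventually_nhds_iff.1
      (((hsc.tendsto T).abs).eventually (gt_mem_nhds (show |(Φ x₀ T).2.1| < ε' / 2 by
        rw [hsT, abs_zero]; positivity)))
    filter_upwards [hx2, hdistC C₁ δ hδ, hdistC C₁ (ε' / 2) (by positivity),
      hdistC (C * C₁) r hr] with x hxpos hx1 hx3 hx4
    obtain ⟨T₁, hT₁, hTT, hsT₁, hpos₁⟩ := hret _ hx1.le _ _ (horb x).hasDerivAt_s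
      (by simp [hΦ0, regInit]) (hcs x)
    rw [hS x T₁ hxpos hT₁.1 hsT₁ hpos₁]
    have hsmall : ∀ τ ∈ uIcc T T₁, |(Φ x τ).2.1| ≤ ε' := by
      intro τ hτ
      have hτT : |τ - T| ≤ |T₁ - T| := abs_sub_left_of_mem_uIcc hτ
      have hτ' : τ ∈ Icc 0 (T + 1) :=
        (uIcc_subset_Icc ⟨hT.le, by linarith⟩ ⟨hT₁.1.le, hT₁.2.le⟩) hτ
      have h1 := hball (y := τ) (by
        rw [Real.dist_eq]
        linarith)
      have h2 := (hcs x τ hτ').1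
      have h3 := abs_sub_abs_le_abs_sub (Φ x τ).2.1 (Φ x₀ τ).2.1
      linarith
    have hmv : ∀ f f' : ℝ → ℝ, (∀ τ, HasDerivAt f (f' τ) τ) →
        (∀ τ ∈ uIcc T T₁, |f' τ| ≤ (A + 1) * ε') →
        |f T₁ - f T| ≤ (A + 1) * (C * C₁) * ε' * ‖x - x₀‖ := by
      intro f f' hf hf'
      have := (convex_uIcc T T₁).norm_image_sub_le_of_norm_hasDerivWithin_le
        (fun τ _ => (hf τ).hasDerivWithinAt) hf' left_mem_uIcc right_mem_uIcc
      calc |f T₁ - f T| ≤ (A + 1) * ε' * |T₁ - T| := this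
        _ ≤ (A + 1) * ε' * (C * (C₁ * ‖x - x₀‖)) := by gcongr
        _ = _ := by ring
    have ht := hmv _ _ (horb x).hasDerivAt_t fun τ hτ => by
      have h1 := hgle (Φ x τ).2.1
      have h2 : A * |(Φ x τ).2.1| ≤ A * ε' := by gcongr; exact hsmall τ hτ
      linarith
    have hz := hmv _ _ (horb x).hasDerivAt_z fun τ hτ => by
      have h1 := hsmall τ hτ
      have h2 : 0 ≤ A * ε' := by positivity
      linarith
    refine (norm_regExit_sub_le hP hB ht hz).trans ?_
    have h5 : M * ε' ≤ ε := by
      rw [hε', mul_div_assoc', div_le_iff₀ (by positivity)]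
      nlinarith
    calc (1 + B) * ((A + 1) * (C * C₁) * ε' * ‖x - x₀‖) = M * ε' * ‖x - x₀‖ := by rw [hM]; ring
      _ ≤ ε * ‖x - x₀‖ := by gcongr
  have hS₀ : S x₀ = regExit P (Φ x₀ T) := hS x₀ T hx₀ hT hsT hpos
  have hdiff : HasFDerivAt (fun x => S x - regExit P (Φ x T)) (0 : ℝ × ℝ →L[ℝ] ℝ × ℝ) x₀ := by
    rw [hasFDerivAt_iff_isLittleO, Asymptotics.isLittleO_iff]
    intro ε hε
    filter_upwards [hlittle ε hε] with x hx
    simpa [hS₀] using hx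
  have hfinal := hdiff.add hexit
  refine ⟨_, hfinal.congr_of_eventuallyEq (Eventually.of_forall fun x => by simp), ?_⟩
  -- the determinant
  have hW := regField_wronskian_eq hg hP (hΦ x₀) hY T 0
  simp only [hY0, hsT, hvel] at hW
  rw [hΦ0] at hW
  simp only [hgdef, cutoffPow_zero, regInit] at hW
  rw [ContinuousLinearMap.det_prod_real]
  simp at hW ⊢
  exact mul_left_cancel₀ hm.ne' (by linear_combination hW)

/-! ### The successor map -/

/-- Every point of `successorDomain` has a successor with positive arrival velocity, and the
successor map is differentiable there with Jacobian determinant `v₀ / w`. -/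
theorem exists_successor_and_hasFDerivAt {α : ℝ} (hα₀ : 0 < α) (hα₁ : α < 1) {p : ℝ → ℝ}
    (hp : Continuous p) {p₁ p₂ : ℝ} (hp₁ : p₁ < 0) (hbound : ∀ t, p₂ ≤ p t ∧ p t ≤ p₁)
    {x₀ : ℝ × ℝ} (hx₀ : x₀ ∈ successorDomain α p₁ p₂) :
    IsSuccessor α p x₀ (successorMap α p x₀) ∧ 0 < (successorMap α p x₀).2 ∧
      ∃ L : ℝ × ℝ →L[ℝ] ℝ × ℝ, HasFDerivAt (successorMap α p) L x₀ ∧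
        L.det * (successorMap α p x₀).2 = x₀.2 := by
  have h1α : 0 < 1 - α := by linarith
  set m : ℝ := (1 - α) / 2 with hm
  set q : ℝ := (1 + α) / (1 - α) with hq
  set η : ℝ := ((α - 1) * p₁) ^ (-1 / α) with hη
  have hbase : 0 < (α - 1) * p₁ := mul_pos_of_neg_of_neg (by linarith) hp₁
  have hηpos : 0 < η := Real.rpow_pos_of_pos hbase _
  have hmpos : 0 < m := by positivity
  have hq1 : 1 < q := by
    rw [hq, lt_div_iff₀ h1α]
    linarith
  have hmq : m * (q + 1) = 1 := by
    rw [hm, hq]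
    field_simp
    ring
  have hqα : q - 1 = (q + 1) * α := by
    rw [hq]
    field_simp
    ring
  -- the level `s = B` is `u = η`
  set B : ℝ := η ^ m with hBdef
  have hB : 0 < B := Real.rpow_pos_of_pos hηpos _
  have hBq1 : B ^ (q + 1) = η := by
    rw [hBdef, ← Real.rpow_mul hηpos.le, hmq, Real.rpow_one]
  have hBq : B ^ (q - 1) = ((α - 1) * p₁)⁻¹ := by
    rw [hBdef, ← Real.rpow_mul hηpos.le, hqα, ← mul_assoc, hmq, one_mul, hη,
      ← Real.rpow_mul hbase.le, div_mul_cancel₀ _ hα₀.ne', Real.rpow_neg_one]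
  have hBq' : -p₁ * B ^ (q - 1) * (2 * m) = 1 := by
    rw [hBq, hm]
    have h1 : α - 1 ≠ 0 := by linarith
    have h2 := hp₁.ne
    field_simp
    ring
  have hγ : velocityThreshold α p₁ p₂ < x₀.2 := hx₀.2
  have hx₀pos : 0 < x₀.2 := (Real.sqrt_nonneg _).trans_lt hγ
  have hv₀ : 2 * (p₁ - p₂) * B ^ (q + 1) < x₀.2 ^ 2 := by
    rw [hBq1]
    exact (Real.sqrt_lt' hx₀pos).1 hγ
  obtain ⟨R, hBR, hR, hRneg⟩ := exists_cutoff_level (m := m) hq1 hp₁ (x₀.2 ^ 2 / 2) B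
  set P := forcingPrimitive p
  have hP : ∀ t, HasDerivAt P (p t) t := hasDerivAt_forcingPrimitive hp
  have hpB : ∀ t, |p t| ≤ -p₂ := fun t => by
    rw [abs_of_nonpos ((hbound t).2.trans hp₁.le)]
    linarith [(hbound t).1]
  obtain ⟨K, hK⟩ := exists_lipschitzWith_regField (m := m) (hasDerivAt_cutoffPow hq1 R) hP
    (abs_cutoffPowDeriv_le hq1 hR.le) hpB
  choose Φ hΦ0 hΦ using fun x => exists_global_solution
    (f := fun _ => regField m (cutoffPow q R) P) (fun _ => continuous_const) (fun _ => hK)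
    (fun _ => le_rfl) (regInit P x)
  have horb : ∀ x, IsRegOrbit m (cutoffPow q R) P (fun τ => (Φ x τ).1) (fun τ => (Φ x τ).2.1)
      (fun τ => (Φ x τ).2.2) := fun x => isRegOrbit_of_hasDerivAt (hΦ x)
  obtain ⟨T, hT, hsT, hvT, hpos⟩ := (horb x₀).exists_return hmpos hq1 hmq hbound hP hB hBq'
    (by rw [hm]; linarith) hBR hRneg hx₀pos hv₀ (by simp [hΦ0, regInit])
    (by simp [hΦ0, regInit])
  have hsucc : ∀ x T₁, 0 < T₁ → (Φ x T₁).2.1 = 0 →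
      (∀ τ ∈ Ioo 0 T₁, 0 < (Φ x τ).2.1 ∧ (Φ x τ).2.1 < R) →
      IsSuccessor α p x (regExit P (Φ x T₁)) := by
    intro x T₁ hT₁ hsT₁ hpos₁
    have := (horb x).isSuccessor hq1 hmq hqα hP hT₁ (by simp [hΦ0, regInit]) hsT₁ hpos₁
    simpa [hΦ0, regInit, regExit] using this
  have hS : ∀ x T₁, 0 < x.2 → 0 < T₁ → (Φ x T₁).2.1 = 0 →
      (∀ τ ∈ Ioo 0 T₁, 0 < (Φ x τ).2.1 ∧ (Φ x τ).2.1 < R) →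
      successorMap α p x = regExit P (Φ x T₁) := fun x T₁ hx hT₁ hsT₁ hpos₁ => by
    have h := hsucc x T₁ hT₁ hsT₁ hpos₁
    exact IsSuccessor.unique hα₀ hα₁ hx (Classical.epsilon_spec ⟨_, h⟩) h
  obtain ⟨L, hL, hdet⟩ := hasFDerivAt_firstReturn hmpos hq1 hR hp hP hpB hΦ0 hΦ hx₀pos hT hsT hvT
    hpos hS
  have hSx₀ := hS x₀ T hx₀pos hT hsT hpos
  refine ⟨?_, ?_, L, hL, ?_⟩
  · rw [hSx₀]
    exact hsucc x₀ T hT hsT hpos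
  · rw [hSx₀]
    exact neg_pos.2 hvT
  · rw [hSx₀]
    exact hdet

theorem mainTheorem4 (α : ℝ) (hα₀ : 0 < α) (hα₁ : α < 1)
    (p : ℝ → ℝ) (hp : Continuous p) (hper : Function.Periodic p (2 * Real.pi))
    (p₁ p₂ : ℝ) (hp₁ : p₁ < 0) (hbound : ∀ t, p₂ ≤ p t ∧ p t ≤ p₁) :
    (∀ x ∈ successorDomain α p₁ p₂,
      (∃! y : ℝ × ℝ, IsSuccessor α p x y) ∧ 0 < (successorMap α p x).2) ∧
    IsAreaPreservingOn (successorMap α p) (successorDomain α p₁ p₂) := by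
  have hmain := fun x hx => exists_successor_and_hasFDerivAt hα₀ hα₁ hp hp₁ hbound (x₀ := x) hx
  have hxpos : ∀ x ∈ successorDomain α p₁ p₂, 0 < x.2 := fun x hx =>
    (Real.sqrt_nonneg _).trans_lt hx.2
  refine ⟨fun x hx => ⟨⟨_, (hmain x hx).1, fun y hy =>
    IsSuccessor.unique hα₀ hα₁ (hxpos x hx) hy (hmain x hx).1⟩, (hmain x hx).2.1⟩, ?_⟩
  intro A hAD hA
  choose! L hL using fun x hx => (hmain x hx).2.2
  have hderiv : ∀ x ∈ A, HasFDerivWithinAt (successorMap α p) (L x) A x := fun x hx =>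
    (hL x (hAD hx)).1.hasFDerivWithinAt
  have hinj : InjOn (successorMap α p) A := fun x hx x' hx' h => by
    have h1 := (hmain x (hAD hx)).1
    rw [h] at h1
    exact IsSuccessor.injective hα₀ hα₁ (hmain x' (hAD hx')).2.1 h1 (hmain x' (hAD hx')).1
  have himage := measurable_image_of_fderivWithin hA hderiv hinj
  refine ⟨himage, ?_⟩
  rw [polarArea, withDensity_apply _ himage, withDensity_apply _ hA,
    lintegral_image_eq_lintegral_abs_det_fderiv_mul volume hA hderiv hinj]
  refine setLIntegral_congr_fun hA fun x hx => ?_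
  have hw := (hmain x (hAD hx)).2.1
  rw [← ENNReal.ofReal_mul (abs_nonneg _), ← abs_of_pos hw, ← abs_mul, (hL x (hAD hx)).2,
    abs_of_pos (hxpos x (hAD hx))]
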